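/- **Conventions.** Fix real constants $F\ge1$, $K\ge0$, $G\ge1$, $H\ge2$. All C*-algebras and *-morphisms are unital; a seminorm defined on a subspace is extended by $+\infty$ outside of this subspace, and $\mathrm{dom}(N)=\{N<\infty\}$. $\mathscr S(\mathfrak A)$ is the state space of $\mathfrak A$. For a seminorm $N$ on (a subspace of) $E$ and functionals $\varphi,\psi$ on $E$, let $\mathsf{mk}_N(\varphi,\psi)=\sup\{|\varphi(x)-\psi(x)|:N(x)\le1\}$. For a distance $d$, let $\mathrm{Haus}_d(A\to B)=\sup_{x\in A}\inf_{y\in B}d(x,y)$ and $\mathrm{Haus}_d(A,B)=\max\{\mathrm{Haus}_d(A\to B),\mathrm{Haus}_d(B\to A)\}$. **Quantum compact metric spaces.** $(\mathfrak A,L)$ is a quantum compact metric space when $L$ is a seminorm on a dense subspace of the self-adjoint part of the C*-algebra $\mathfrak A$ with $L(1)=0$, $\mathsf{mk}_L$ is a (finite) metric inducing the weak* topology on $\mathscr S(\mathfrak A)$, $\{L\le1\}$ is closed, and $\max\{L(\Re(ab)),L(\Im(ab))\}\le F(L(a)\|b\|+\|a\|L(b))+K\,L(a)L(b)$ on $\mathrm{dom}(L)$.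 **Metrical C*-correspondences.** $(\mathscr M,\mathsf D,\mathfrak A,L,\mathfrak B,S)$ is a metrical C*-correspondence when $(\mathfrak A,L)$, $(\mathfrak B,S)$ are quantum compact metric spaces, $\mathscr M$ is a right Hilbert $\mathfrak B$-module with a left action of $\mathfrak A$ by adjointable operators, and $\mathsf D$ is a norm on a dense subspace of $\mathscr M$ with $\mathsf D\ge\|\cdot\|_{\mathscr M}$, with $\{\mathsf D\le1\}$ compact, $\mathsf D(a\omega)\le G(\|a\|+L(a))\mathsf D(\omega)$ and $\max\{S(\Re\langle\omega,\eta\rangle),S(\Im\langle\omega,\eta\rangle)\}\le H\,\mathsf D(\omega)\mathsf D(\eta)$ on the domains. A modular quantum isometry $(\Pi,\pi,\theta)$ consists of a continuous linear map $\Pi$ of the modules and *-morphisms $\pi$, $\theta$ of the left and right algebras, with $\Pi(a\omega)=\pi(a)\Pi(\omega)$, $\Pi(\omega b)=\Pi(\omega)\theta(b)$, $\theta\langle\omega,\eta\rangle=\langle\Pi\omega,\Pi\eta\rangle$, which map the domains of the D-norm and of the two seminorms into the corresponding domains, and such that the D-norm and the seminorms of the codomain are, on their domains, the quotients (infima over preimages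 in the domain) of those of the domain. **Tunnels.** A tunnel $\tau$ from $\mathbb M_1$ to $\mathbb M_2$ is a metrical C*-correspondence $\mathbb P=(\mathscr P,\mathsf T,\mathfrak D,L_{\mathfrak D},\mathfrak E,L_{\mathfrak E})$ with modular quantum isometries $(\Pi_j,\pi_j,\theta_j):\mathbb P\to\mathbb M_j$, $j=1,2$; $\tau^{-1}$ is obtained by exchanging the two. Writing $\mathfrak A_j,\mathfrak B_j$ for the left and right algebras of $\mathbb M_j$, the extent of $\tau$ is $$\chi(\tau)=\max_{j=1,2}\max\{\mathrm{Haus}_{\mathsf{mk}_{L_{\mathfrak D}}}(\pi_j^*\mathscr S(\mathfrak A_j),\mathscr S(\mathfrak D)),\ \mathrm{Haus}_{\mathsf{mk}_{L_{\mathfrak E}}}(\theta_j^*\mathscr S(\mathfrak B_j),\mathscr S(\mathfrak E))\}.$$ A pseudo-state of a metrical C*-correspondence is a functional $\xi\mapsto\mu(\langle\omega,\xi\rangle)$ with $\mu$ a state of the right algebra and D-norm of $\omega$ at most $1$. For families $A=(a_j)_{j\in J}$, $B=(b_j)_{j\in J}$ of adjointable operators on $\mathbb M_1,\mathbb M_2$,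 the separation $\mathrm{sep}_\tau(A,B)$ is the Hausdorff distance, for $\sup_{j\in J}\mathsf{mk}_{\mathsf T}$, between $\{(\varphi\circ a_j\circ\Pi_1)_j\}$ and $\{(\psi\circ b_j\circ\Pi_2)_j\}$, where $\varphi$, $\psi$ range over the pseudo-states of $\mathbb M_1$, $\mathbb M_2$. The dispersion is $\mathrm{dis}_\tau(A,B)=\max\{\chi(\tau),\mathrm{sep}_\tau(A,B)\}$, and the operational propinquity $\Lambda^{\mathrm{op}}(A,B)$ is the infimum of $\mathrm{dis}_\tau(A,B)$ over all tunnels $\tau$ from $\mathbb M_1$ to $\mathbb M_2$. **Metric spectral triples.** A spectral triple $(\mathfrak A,\mathscr H,D)$ is a C*-algebra $\mathfrak A$ represented on a Hilbert space $\mathscr H$ together with a self-adjoint operator $D$ with dense domain such that $D+i$ has a compact inverse and the self-adjoint $a$ with $a\,\mathrm{dom}(D)\subseteq\mathrm{dom}(D)$ and $[D,a]$ bounded are dense in the self-adjoint part of $\mathfrak A$. It is metric when $(\mathfrak A,L_D)$, with $L_D(a)=\|[D,a]\|$ for these $a$, is a quantum compact metric space. Its metrical C*-correspondence is $(\mathscr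 H,\mathsf D_D,\mathfrak A,L_D,\mathbb C,0)$ with $\mathsf D_D(\xi)=\|\xi\|+\|D\xi\|$ on $\mathrm{dom}(D)$; a tunnel between metric spectral triples is a tunnel between their metrical C*-correspondences. Write $U_D^t=\exp(itD)$. An $\varepsilon$-iso-iso is a pair of maps $\varsigma_1,\varsigma_2:[0,\infty)\to[0,\infty)$ with $\varsigma_1(0)=\varsigma_2(0)=0$ and $\big||\varsigma_j(x)+\varsigma_j(y)-z|-|x+y-\varsigma_k(z)|\big|<\varepsilon$ for all $x,y,z\in[0,\frac1\varepsilon]$ and $\{j,k\}=\{1,2\}$. The $\varepsilon$-magnitude of $(\tau,\varsigma_1,\varsigma_2)$ is $\max\{\chi(\tau),r(\tau,\varsigma_1),r(\tau^{-1},\varsigma_2)\}$, where $r(\tau,\varsigma)$ is $\mathrm{Haus}_d(X\to Y)$ for $d=\sup_{t}\mathsf{mk}_{\mathsf T}$, $$X=\{(\langle U_{D_1}^{-t}\xi,\Pi_1(\cdot)\rangle)_{0\le t\le1/\varepsilon}:\mathsf D_{D_1}(\xi)\le1\},\qquad Y=\{(\langle U_{D_2}^{-\varsigma(t)}\xi,\Pi_2(\cdot)\rangle)_{0\le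 t\le1/\varepsilon}:\mathsf D_{D_2}(\xi)\le1\}.$$ The spectral propinquity $\Lambda^{\mathrm{spec}}$ between two metric spectral triples is the infimum of $\frac{\sqrt2}2$ and of all $\varepsilon>0$ for which there are a tunnel $\tau$ and an $\varepsilon$-iso-iso such that the $\varepsilon$-magnitude is $<\varepsilon$. Let $\Lambda^*$ be the infimum of $\frac{\sqrt2}2$ and of all $\varepsilon>0$ for which there is a tunnel $\tau$ with $\mathrm{dis}_\tau((U_{D_1}^t)_{0\le t\le1/\varepsilon},(U_{D_2}^t)_{0\le t\le1/\varepsilon})<\varepsilon$. **Theorem.** Let $(\mathfrak A_n,\mathscr H_n,D_n)_{n\in\mathbb N}$ be a sequence of metric spectral triples converging to a metric spectral triple $(\mathfrak A_\infty,\mathscr H_\infty,D_\infty)$ for the spectral propinquity, i.e. $\Lambda^{\mathrm{spec}}((\mathfrak A_n,\mathscr H_n,D_n),(\mathfrak A_\infty,\mathscr H_\infty,D_\infty))\to0$. Write $U_n^t=\exp(itD_n)$ for $n\in\mathbb N\cup\{\infty\}$. (1) Let $(\mu_n)$ be a real sequence with $\mu_n>\Lambda^*((\mathfrak A_n,\mathscr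 H_n,D_n),(\mathfrak A_\infty,\mathscr H_\infty,D_\infty))$ and $\mu_n\to0$, let $C_n=[-\frac1{2\mu_n},\frac1{2\mu_n}]$, and let $\tau_n$ be a tunnel from $(\mathfrak A_n,\mathscr H_n,D_n)$ to $(\mathfrak A_\infty,\mathscr H_\infty,D_\infty)$ with $\mathrm{dis}_{\tau_n}((U_n^t)_{t\in C_n},(U_\infty^t)_{t\in C_n})\le\mu_n$. Then for every $f\in C_0(\mathbb R)$ $$\lim_{n\to\infty}\mathrm{sep}_{\tau_n}\big(((U_n^t)_{t\in C_n},f(D_n)),\ ((U_\infty^t)_{t\in C_n},f(D_\infty))\big)=0,$$ where $((U^t)_{t\in C_n},f(D))$ is the family indexed by the disjoint union of $C_n$ and one point. (2) In particular, for every $f\in C_0(\mathbb R)$, $\lim_{n\to\infty}\Lambda^{\mathrm{op}}(f(D_n),f(D_\infty))=0$. -/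

import Mathlib

open Filter Topology
open scoped ENNReal NNReal ComplexOrder ComplexStarModule InnerProductSpace
  BoundedContinuousFunction ZeroAtInfty

universe u v w w'

namespace SpectralPropinquity

noncomputable section

/-! ### Conventions

A (semi)norm `N` defined on a subspace of `E` is encoded by its extension `N : E → ℝ≥0∞`, which is
`⊤` outside of the domain; thus the domain of `N` is `{x | N x < ⊤}`. -/

/-- The constants `(F, K, G, H)` of the quasi-Leibniz inequalities, fixed once and for all. -/
structure LeibnizParams where
  F : ℝ
  K : ℝ
  G : ℝ
  H : ℝ
  one_le_F : 1 ≤ F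
  K_nonneg : 0 ≤ K
  one_le_G : 1 ≤ G
  two_le_H : 2 ≤ H

/-! ### Hausdorff distance -/

/-- `sup_{x ∈ A} inf_{y ∈ B} d(x, y)`. -/
def hausdorffTo {X : Type*} (d : X → X → ℝ≥0∞) (A B : Set X) : ℝ≥0∞ :=
  ⨆ x ∈ A, ⨅ y ∈ B, d x y

/-- The Hausdorff distance associated with `d`. -/
def hausdorff {X : Type*} (d : X → X → ℝ≥0∞) (A B : Set X) : ℝ≥0∞ :=
  max (hausdorffTo d A B) (hausdorffTo d B A)

/-! ### Quantum compact metric spaces -/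

/-- The state space of a unital C*-algebra, with the weak* topology. -/
def StateSpace (A : Type*) [CStarAlgebra A] : Set (WeakDual ℂ A) :=
  {φ | φ 1 = 1 ∧ ∀ a : A, 0 ≤ φ (star a * a)}

/-- The Monge-Kantorovich distance `sup {|φ x - ψ x| : N x ≤ 1}` of two functionals. -/
def kantorovich {E : Type*} (N : E → ℝ≥0∞) (φ ψ : E → ℂ) : ℝ≥0∞ :=
  ⨆ (x : E) (_ : N x ≤ 1), ‖φ x - ψ x‖ₑ

/-- `(A, L)` is an `(F, K)`-quantum compact metric space. -/
structure IsQuantumMetric (F K : ℝ) {A : Type*} [CStarAlgebra A] (L : A → ℝ≥0∞) : Prop where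
  isSelfAdjoint_of_lt_top : ∀ a, L a < ⊤ → IsSelfAdjoint a
  add_le : ∀ a b, L (a + b) ≤ L a + L b
  map_smul : ∀ (r : ℝ) (a : A), IsSelfAdjoint a → L (r • a) = ‖r‖ₑ * L a
  dense_domain : ∀ a, IsSelfAdjoint a → a ∈ closure {b | L b < ⊤}
  map_one : L 1 = 0
  kantorovich_ne_top : ∀ φ ∈ StateSpace A, ∀ ψ ∈ StateSpace A, kantorovich L φ ψ ≠ ⊤
  /-- The Monge-Kantorovich metric induces the weak* topology on the state space. -/
  nhds_basis : ∀ φ : StateSpace A, (𝓝 φ).HasBasis (fun ε : ℝ≥0∞ => 0 < ε)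
    (fun ε => {ψ : StateSpace A | kantorovich L φ.1 ψ.1 < ε})
  leibniz : ∀ a b, L a < ⊤ → L b < ⊤ →
    max (L (ℜ (a * b) : A)) (L (ℑ (a * b) : A)) ≤
      ENNReal.ofReal F * (L a * ‖b‖ₑ + ‖a‖ₑ * L b) + ENNReal.ofReal K * L a * L b
  isClosed_ball : IsClosed {a | L a ≤ 1}

/-! ### Metrical C*-correspondences -/

/-- A right Hilbert C*-module `M` over the unital C*-algebra `B` (completeness of `M` is asked
separately); the right action of `b` is that of `MulOpposite.op b`. -/
class RightHilbertModule (B M : Type*) [CStarAlgebra B] [NormedAddCommGroup M] [NormedSpace ℂ M]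
    [Module Bᵐᵒᵖ M] extends Inner B M where
  inner_add_right : ∀ x y z : M, inner x (y + z) = inner x y + inner x z
  inner_smul_right : ∀ (c : ℂ) (x y : M), inner x (c • y) = c • inner x y
  inner_op_smul_right : ∀ (b : B) (x y : M), inner x (MulOpposite.op b • y) = inner x y * b
  star_inner : ∀ x y : M, star (inner x y) = inner y x
  inner_self_nonneg : ∀ x : M, ∃ b : B, inner x x = star b * b
  inner_self_eq_zero : ∀ x : M, inner x x = 0 ↔ x = 0
  norm_sq_eq : ∀ x : M, ‖x‖ ^ 2 = ‖inner x x‖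

set_option linter.checkUnivs false in
/-- An `(F, K, G, H)`-metrical C*-correspondence `(Mod, DN, Alg, L, Coef, S)`. -/
structure MetricalCorrespondence (p : LeibnizParams) where
  Mod : Type u
  Alg : Type v
  Coef : Type w
  [algInst : CStarAlgebra Alg]
  [coefInst : CStarAlgebra Coef]
  [modNormed : NormedAddCommGroup Mod]
  [modSpace : NormedSpace ℂ Mod]
  [modComplete : CompleteSpace Mod]
  [rightModule : Module Coefᵐᵒᵖ Mod]
  [hilbertModule : RightHilbertModule Coef Mod]
  /-- The left action, a unital *-morphism into the adjointable operators. -/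
  act : Alg →ₐ[ℂ] (Mod →L[ℂ] Mod)
  inner_act : ∀ (a : Alg) (ω η : Mod), inner Coef (act a ω) η = inner Coef ω (act (star a) η)
  /-- The D-norm. -/
  DN : Mod → ℝ≥0∞
  L : Alg → ℝ≥0∞
  S : Coef → ℝ≥0∞
  quantumMetric_L : IsQuantumMetric p.F p.K L
  quantumMetric_S : IsQuantumMetric p.F p.K S
  DN_add_le : ∀ ω η, DN (ω + η) ≤ DN ω + DN η
  DN_smul : ∀ (c : ℂ) ω, DN (c • ω) = ‖c‖ₑ * DN ω
  DN_dense : Dense {ω | DN ω < ⊤}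
  enorm_le_DN : ∀ ω, ‖ω‖ₑ ≤ DN ω
  isCompact_DN_ball : IsCompact {ω | DN ω ≤ 1}
  modular_leibniz : ∀ a ω, L a < ⊤ → DN ω < ⊤ →
    DN (act a ω) ≤ ENNReal.ofReal p.G * (‖a‖ₑ + L a) * DN ω
  inner_leibniz : ∀ ω η, DN ω < ⊤ → DN η < ⊤ →
    max (S (ℜ (inner Coef ω η) : Coef)) (S (ℑ (inner Coef ω η) : Coef)) ≤
      ENNReal.ofReal p.H * DN ω * DN η

attribute [instance] MetricalCorrespondence.algInst MetricalCorrespondence.coefInst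
  MetricalCorrespondence.modNormed MetricalCorrespondence.modSpace
  MetricalCorrespondence.modComplete MetricalCorrespondence.rightModule
  MetricalCorrespondence.hilbertModule

variable {p : LeibnizParams}

/-- A modular quantum isometry: a Lipschitz morphism whose three components have as quotient
seminorms the given seminorms of the codomain. -/
structure ModularQuantumIsometry (M₁ : MetricalCorrespondence.{u, v, w} p)
    (M₂ : MetricalCorrespondence.{u, v, w'} p) where
  toMod : M₁.Mod →L[ℂ] M₂.Mod
  toAlg : M₁.Alg →⋆ₐ[ℂ] M₂.Alg
  toCoef : M₁.Coef →⋆ₐ[ℂ] M₂.Coef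
  map_act : ∀ a ω, toMod (M₁.act a ω) = M₂.act (toAlg a) (toMod ω)
  map_right : ∀ (b : M₁.Coef) (ω : M₁.Mod),
    toMod (MulOpposite.op b • ω) = MulOpposite.op (toCoef b) • toMod ω
  map_inner : ∀ ω η, toCoef (inner M₁.Coef ω η) = inner M₂.Coef (toMod ω) (toMod η)
  map_dom_L : ∀ a, M₁.L a < ⊤ → M₂.L (toAlg a) < ⊤
  map_dom_S : ∀ b, M₁.S b < ⊤ → M₂.S (toCoef b) < ⊤
  map_dom_DN : ∀ ω, M₁.DN ω < ⊤ → M₂.DN (toMod ω) < ⊤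
  L_eq : ∀ a, M₂.L a < ⊤ → M₂.L a = sInf (M₁.L '' {d | M₁.L d < ⊤ ∧ toAlg d = a})
  S_eq : ∀ b, M₂.S b < ⊤ → M₂.S b = sInf (M₁.S '' {d | M₁.S d < ⊤ ∧ toCoef d = b})
  DN_eq : ∀ ω, M₂.DN ω < ⊤ → M₂.DN ω = sInf (M₁.DN '' {η | M₁.DN η < ⊤ ∧ toMod η = ω})

/-! ### Tunnels and their extent -/

/-- A metrical tunnel from `M₁` to `M₂`. -/
structure Tunnel (M₁ M₂ : MetricalCorrespondence.{u, u, w} p) where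
  P : MetricalCorrespondence.{u, u, u} p
  fst : ModularQuantumIsometry P M₁
  snd : ModularQuantumIsometry P M₂

/-- The tunnel with domain and codomain exchanged. -/
def Tunnel.symm {M₁ M₂ : MetricalCorrespondence.{u, u, w} p} (τ : Tunnel M₁ M₂) : Tunnel M₂ M₁ :=
  ⟨τ.P, τ.snd, τ.fst⟩

/-- The set `{φ ∘ π : φ a state of A}` of states of `D`. -/
def pulledBackStates {D A : Type*} [CStarAlgebra D] [CStarAlgebra A] (π : D →⋆ₐ[ℂ] A) :
    Set (WeakDual ℂ D) :=
  {ψ | ∃ φ ∈ StateSpace A, ∀ d, ψ d = φ (π d)}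

/-- The extent of a tunnel. -/
def Tunnel.extent {M₁ M₂ : MetricalCorrespondence.{u, u, w} p} (τ : Tunnel M₁ M₂) : ℝ≥0∞ :=
  max
    (max
      (hausdorff (fun φ ψ : WeakDual ℂ τ.P.Alg => kantorovich τ.P.L φ ψ)
        (pulledBackStates τ.fst.toAlg) (StateSpace τ.P.Alg))
      (hausdorff (fun φ ψ : WeakDual ℂ τ.P.Coef => kantorovich τ.P.S φ ψ)
        (pulledBackStates τ.fst.toCoef) (StateSpace τ.P.Coef)))
    (max
      (hausdorff (fun φ ψ : WeakDual ℂ τ.P.Alg => kantorovich τ.P.L φ ψ)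
        (pulledBackStates τ.snd.toAlg) (StateSpace τ.P.Alg))
      (hausdorff (fun φ ψ : WeakDual ℂ τ.P.Coef => kantorovich τ.P.S φ ψ)
        (pulledBackStates τ.snd.toCoef) (StateSpace τ.P.Coef)))

/-! ### Families of adjointable operators -/

/-- The adjointable operators on the Hilbert module of `M`. -/
def MetricalCorrespondence.Adjointable (M : MetricalCorrespondence.{u, v, w} p) : Type u :=
  {T : M.Mod →L[ℂ] M.Mod // ∃ T' : M.Mod → M.Mod,
    ∀ ω η, inner M.Coef (T ω) η = inner M.Coef ω (T' η)}

/-- The pseudo-states `ξ ↦ μ ⟨ω, ξ⟩`, where `μ` is a state and `DN ω ≤ 1`. -/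
def MetricalCorrespondence.pseudoStates (M : MetricalCorrespondence.{u, v, w} p) :
    Set (M.Mod →L[ℂ] ℂ) :=
  {φ | ∃ μ ∈ StateSpace M.Coef, ∃ ω : M.Mod, M.DN ω ≤ 1 ∧ ∀ ξ, φ ξ = μ (inner M.Coef ω ξ)}

/-- The Kantorovich distance between two families of functionals. -/
def kantorovichFamily (M : MetricalCorrespondence.{u, v, w} p) {J : Type*}
    (Φ Ψ : J → M.Mod →L[ℂ] ℂ) : ℝ≥0∞ :=
  ⨆ j, kantorovich M.DN (Φ j) (Ψ j)

/-- The separation of two families of operators according to a tunnel. -/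
def Tunnel.separation {M₁ M₂ : MetricalCorrespondence.{u, u, w} p} (τ : Tunnel M₁ M₂)
    {J : Type*} (a : J → M₁.Adjointable) (b : J → M₂.Adjointable) : ℝ≥0∞ :=
  hausdorff (kantorovichFamily τ.P)
    {Φ : J → τ.P.Mod →L[ℂ] ℂ | ∃ φ ∈ M₁.pseudoStates,
      Φ = fun j => (φ.comp (a j).1).comp τ.fst.toMod}
    {Φ : J → τ.P.Mod →L[ℂ] ℂ | ∃ ψ ∈ M₂.pseudoStates,
      Φ = fun j => (ψ.comp (b j).1).comp τ.snd.toMod}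

/-- The dispersion of two families of operators according to a tunnel. -/
def Tunnel.dispersion {M₁ M₂ : MetricalCorrespondence.{u, u, w} p} (τ : Tunnel M₁ M₂)
    {J : Type*} (a : J → M₁.Adjointable) (b : J → M₂.Adjointable) : ℝ≥0∞ :=
  max τ.extent (τ.separation a b)

/-- The operational propinquity between two families of operators. -/
def operationalPropinquity {M₁ M₂ : MetricalCorrespondence.{u, u, w} p}
    {J : Type*} (a : J → M₁.Adjointable) (b : J → M₂.Adjointable) : ℝ≥0∞ :=
  ⨅ τ : Tunnel M₁ M₂, τ.dispersion a b

/-! ### Metric spectral triples -/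

/-- The operator norm of `[D, a]`, for `a` self-adjoint with `a dom D ⊆ dom D` and `[D, a]` bounded;
the value is `⊤` for all other elements (the infimum is then over the empty set). -/
def commutatorSeminorm {A H : Type*} [CStarAlgebra A] [NormedAddCommGroup H]
    [InnerProductSpace ℂ H] [CompleteSpace H] (rep : A →⋆ₐ[ℂ] (H →L[ℂ] H)) (D : H →ₗ.[ℂ] H)
    (a : A) : ℝ≥0∞ :=
  ⨅ (C : ℝ≥0) (_ : IsSelfAdjoint a ∧ ∀ ξ : D.domain, ∃ h : rep a ξ ∈ D.domain,
    ‖D ⟨rep a ξ, h⟩ - rep a (D ξ)‖ ≤ C * ‖(ξ : H)‖), (C : ℝ≥0∞)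

/-- The graph norm `‖ξ‖ + ‖D ξ‖` on the domain of `D`, and `⊤` elsewhere. -/
def graphNorm {H : Type*} [NormedAddCommGroup H] [InnerProductSpace ℂ H] (D : H →ₗ.[ℂ] H)
    (ξ : H) : ℝ≥0∞ :=
  ⨅ h : ξ ∈ D.domain, (‖ξ‖ₑ + ‖D ⟨ξ, h⟩‖ₑ)

/-- A spectral triple. -/
structure SpectralTriple where
  Alg : Type u
  Hil : Type u
  [algInst : CStarAlgebra Alg]
  [hilNormed : NormedAddCommGroup Hil]
  [hilInner : InnerProductSpace ℂ Hil]
  [hilComplete : CompleteSpace Hil]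
  rep : Alg →⋆ₐ[ℂ] (Hil →L[ℂ] Hil)
  D : Hil →ₗ.[ℂ] Hil
  dense_domain : Dense (D.domain : Set Hil)
  isSelfAdjoint : IsSelfAdjoint D
  /-- `D + i` has a compact inverse. -/
  compact_inverse : ∃ R : Hil →L[ℂ] Hil, IsCompactOperator R ∧
    (∀ η, ∃ h : R η ∈ D.domain, D ⟨R η, h⟩ + Complex.I • R η = η) ∧
    ∀ ξ : D.domain, R (D ξ + Complex.I • (ξ : Hil)) = ξ
  dense_lipschitz : ∀ a, IsSelfAdjoint a → a ∈ closure {b | commutatorSeminorm rep D b < ⊤}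

attribute [instance] SpectralTriple.algInst SpectralTriple.hilNormed SpectralTriple.hilInner
  SpectralTriple.hilComplete

/-- A metric spectral triple. -/
structure MetricSpectralTriple (p : LeibnizParams) extends SpectralTriple.{u} where
  quantumMetric : IsQuantumMetric p.F p.K (commutatorSeminorm rep D)

/-! #### The metrical C*-correspondence of a metric spectral triple -/

/-- The right action of `ℂ` on a complex Hilbert space. -/
abbrev rightScalars (H : Type*) [NormedAddCommGroup H] [InnerProductSpace ℂ H] : Module ℂᵐᵒᵖ H :=
  Module.compHom H (RingEquiv.toOpposite ℂ).symm.toRingHom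

/-- A complex Hilbert space as a right Hilbert module over `ℂ`. -/
abbrev hilbertSpaceModule (H : Type*) [NormedAddCommGroup H] [InnerProductSpace ℂ H] :
    letI := rightScalars H
    RightHilbertModule ℂ H :=
  letI := rightScalars H
  { inner := fun x y => inner ℂ x y
    inner_add_right := fun x y z => _root_.inner_add_right x y z
    inner_smul_right := fun c x y => by
      rw [_root_.inner_smul_right, smul_eq_mul]
    inner_op_smul_right := fun b x y => by
      change inner ℂ x (b • y) = _
      rw [_root_.inner_smul_right, mul_comm]
    star_inner := fun x y => inner_conj_symm y x
    inner_self_nonneg := fun x => ⟨(‖x‖ : ℂ), by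
      rw [inner_self_eq_norm_sq_to_K]
      simp [sq]⟩
    inner_self_eq_zero := fun x => _root_.inner_self_eq_zero
    norm_sq_eq := fun x => by
      rw [inner_self_eq_norm_sq_to_K]
      simp }

/-- The zero seminorm on the self-adjoint part `ℝ` of `ℂ` (and `⊤` outside of `ℝ`). -/
def zeroSeminorm (z : ℂ) : ℝ≥0∞ := ⨅ _ : IsSelfAdjoint z, 0

theorem zeroSeminorm_of_isSelfAdjoint {z : ℂ} (hz : IsSelfAdjoint z) : zeroSeminorm z = 0 := by
  simp [zeroSeminorm, hz]

theorem isSelfAdjoint_of_zeroSeminorm {z : ℂ} (hz : zeroSeminorm z < ⊤) : IsSelfAdjoint z := by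
  by_contra h
  simp [zeroSeminorm, h] at hz

theorem zeroSeminorm_isQuantumMetric {F K : ℝ} : IsQuantumMetric F K zeroSeminorm := by
  have hstate : ∀ φ ∈ StateSpace ℂ, ∀ z, φ z = z := by
    intro φ hφ z
    have : φ (z • (1 : ℂ)) = z • φ 1 := map_smul φ z 1
    rw [hφ.1] at this
    simpa using this
  refine ⟨fun a => isSelfAdjoint_of_zeroSeminorm, ?_, ?_, ?_, ?_, ?_, ?_, ?_, ?_⟩
  · intro a b
    by_cases ha : IsSelfAdjoint a
    · by_cases hb : IsSelfAdjoint b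
      · simp [zeroSeminorm_of_isSelfAdjoint (ha.add hb)]
      · simp [zeroSeminorm, hb]
    · simp [zeroSeminorm, ha]
  · intro r a ha
    rw [zeroSeminorm_of_isSelfAdjoint ha, mul_zero]
    exact zeroSeminorm_of_isSelfAdjoint (IsSelfAdjoint.smul (IsSelfAdjoint.all r) ha)
  · intro a ha
    exact subset_closure (by simp [zeroSeminorm_of_isSelfAdjoint ha])
  · exact zeroSeminorm_of_isSelfAdjoint (IsSelfAdjoint.one ℂ)
  · intro φ hφ ψ hψ
    simp [kantorovich, hstate φ hφ, hstate ψ hψ]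
  · intro φ
    have hsub : ∀ ψ : StateSpace ℂ, ψ = φ := by
      intro ψ
      apply Subtype.ext
      apply DFunLike.ext
      intro z
      rw [hstate _ ψ.2, hstate _ φ.2]
    refine ⟨fun t => ⟨fun ht => ⟨1, one_pos, fun ψ _ => hsub ψ ▸ mem_of_mem_nhds ht⟩, ?_⟩⟩
    rintro ⟨ε, hε, ht⟩
    have : t = Set.univ := by
      refine Set.eq_univ_of_forall fun ψ => ht ?_
      have : kantorovich zeroSeminorm φ.1 ψ.1 = 0 := by
        simp [kantorovich, hstate _ φ.2, hstate _ ψ.2]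
      simpa [this] using hε
    rw [this]
    exact univ_mem
  · intro a b _ _
    rw [zeroSeminorm_of_isSelfAdjoint (ℜ (a * b)).2, zeroSeminorm_of_isSelfAdjoint (ℑ (a * b)).2]
    simp
  · have : {a | zeroSeminorm a ≤ 1} = {a : ℂ | star a = a} := by
      ext a
      constructor
      · intro h
        exact isSelfAdjoint_of_zeroSeminorm (lt_of_le_of_lt h ENNReal.one_lt_top)
      · intro h
        simp [zeroSeminorm_of_isSelfAdjoint (z := a) h]
    rw [this]
    exact isClosed_eq continuous_star continuous_id

section GraphNorm

variable {H : Type*} [NormedAddCommGroup H] [InnerProductSpace ℂ H] {D : H →ₗ.[ℂ] H}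

theorem graphNorm_of_mem {ξ : H} (h : ξ ∈ D.domain) :
    graphNorm D ξ = ‖ξ‖ₑ + ‖D ⟨ξ, h⟩‖ₑ := by
  simp [graphNorm, h]

theorem mem_domain_of_graphNorm {ξ : H} (h : graphNorm D ξ < ⊤) : ξ ∈ D.domain := by
  by_contra h'
  simp [graphNorm, h'] at h

theorem graphNorm_lt_top_iff {ξ : H} : graphNorm D ξ < ⊤ ↔ ξ ∈ D.domain :=
  ⟨mem_domain_of_graphNorm, fun h => by
    rw [graphNorm_of_mem h]
    exact ENNReal.add_lt_top.2 ⟨enorm_lt_top, enorm_lt_top⟩⟩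

theorem enorm_le_graphNorm (ξ : H) : ‖ξ‖ₑ ≤ graphNorm D ξ :=
  le_iInf fun _ => le_self_add

theorem graphNorm_add_le (ξ η : H) : graphNorm D (ξ + η) ≤ graphNorm D ξ + graphNorm D η := by
  by_cases hξ : ξ ∈ D.domain
  · by_cases hη : η ∈ D.domain
    · have e : D ⟨ξ + η, D.domain.add_mem hξ hη⟩ = D ⟨ξ, hξ⟩ + D ⟨η, hη⟩ :=
        D.map_add ⟨ξ, hξ⟩ ⟨η, hη⟩
      rw [graphNorm_of_mem hξ, graphNorm_of_mem hη, graphNorm_of_mem (D.domain.add_mem hξ hη), e,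
        add_add_add_comm]
      exact add_le_add (enorm_add_le _ _) (enorm_add_le _ _)
    · simp [graphNorm, hη]
  · simp [graphNorm, hξ]

theorem graphNorm_smul (c : ℂ) (ξ : H) : graphNorm D (c • ξ) = ‖c‖ₑ * graphNorm D ξ := by
  by_cases hc : c = 0
  · subst hc
    have e : D ⟨0, D.domain.zero_mem⟩ = 0 := D.map_zero
    simp [graphNorm_of_mem D.domain.zero_mem, e]
  by_cases hξ : ξ ∈ D.domain
  · have e : D ⟨c • ξ, D.domain.smul_mem c hξ⟩ = c • D ⟨ξ, hξ⟩ := D.map_smul c ⟨ξ, hξ⟩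
    rw [graphNorm_of_mem hξ, graphNorm_of_mem (D.domain.smul_mem c hξ), e, enorm_smul, enorm_smul,
      mul_add]
  · have : c • ξ ∉ D.domain := fun h => hξ (by
      simpa [smul_smul, inv_mul_cancel₀ hc] using D.domain.smul_mem c⁻¹ h)
    simp [graphNorm, hξ, this, ENNReal.mul_top, hc]

theorem graphNorm_le_one_iff_real {ξ : H} :
    graphNorm D ξ ≤ 1 ↔ ∃ h : ξ ∈ D.domain, ‖ξ‖ + ‖D ⟨ξ, h⟩‖ ≤ 1 := by
  have key : ∀ h : ξ ∈ D.domain, graphNorm D ξ = ENNReal.ofReal (‖ξ‖ + ‖D ⟨ξ, h⟩‖) := by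
    intro h
    rw [graphNorm_of_mem h, ENNReal.ofReal_add (norm_nonneg _) (norm_nonneg _), ofReal_norm,
      ofReal_norm]
  constructor
  · intro h
    have hm := mem_domain_of_graphNorm (lt_of_le_of_lt h ENNReal.one_lt_top)
    refine ⟨hm, ?_⟩
    rwa [key hm, ENNReal.ofReal_le_one] at h
  · rintro ⟨hm, h⟩
    rwa [key hm, ENNReal.ofReal_le_one]

variable [CompleteSpace H]

/-- A self-adjoint operator is recovered from its matrix coefficients. -/
theorem graphNorm_le_one_iff (hd : Dense (D.domain : Set H)) (hD : IsSelfAdjoint D) {ξ : H} :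
    graphNorm D ξ ≤ 1 ↔ ‖ξ‖ ≤ 1 ∧
      ∀ ζ : D.domain, ‖inner ℂ (D ζ) ξ‖ ≤ (1 - ‖ξ‖) * ‖(ζ : H)‖ := by
  have hsym : D.IsFormalAdjoint D := by
    have := LinearPMap.adjoint_isFormalAdjoint hd
    rwa [LinearPMap.isSelfAdjoint_def.1 hD] at this
  rw [graphNorm_le_one_iff_real]
  constructor
  · rintro ⟨hm, h⟩
    refine ⟨by linarith [norm_nonneg (D ⟨ξ, hm⟩)], fun ζ => ?_⟩
    rw [hsym ζ ⟨ξ, hm⟩, mul_comm]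
    exact (norm_inner_le_norm _ _).trans
      (mul_le_mul_of_nonneg_left (by linarith) (norm_nonneg _))
  · rintro ⟨h1, h⟩
    have hm : ξ ∈ D.domain := by
      rw [← LinearPMap.isSelfAdjoint_def.1 hD, LinearPMap.mem_adjoint_domain_iff]
      refine AddMonoidHomClass.continuous_of_bound _ (1 - ‖ξ‖) fun ζ => ?_
      have := h ζ
      rw [← norm_inner_symm] at this
      exact this
    refine ⟨hm, ?_⟩
    have hb : ∀ ζ : H, ‖inner ℂ ζ (D ⟨ξ, hm⟩)‖ ≤ (1 - ‖ξ‖) * ‖ζ‖ := by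
      intro ζ
      refine hd.induction (P := fun ζ => ‖inner ℂ ζ (D ⟨ξ, hm⟩)‖ ≤ (1 - ‖ξ‖) * ‖ζ‖) ?_ ?_ ζ
      · intro ζ hζ
        have := h ⟨ζ, hζ⟩
        rwa [hsym ⟨ζ, hζ⟩ ⟨ξ, hm⟩] at this
      · exact isClosed_le (by fun_prop) (by fun_prop)
    have := hb (D ⟨ξ, hm⟩)
    rw [inner_self_eq_norm_sq_to_K] at this
    have h2 : ‖D ⟨ξ, hm⟩‖ * ‖D ⟨ξ, hm⟩‖ ≤ (1 - ‖ξ‖) * ‖D ⟨ξ, hm⟩‖ := by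
      simpa [sq] using this
    rcases (norm_nonneg (D ⟨ξ, hm⟩)).eq_or_lt with h0 | h0
    · rw [← h0]
      linarith
    · linarith [le_of_mul_le_mul_right h2 h0]

theorem isClosed_graphNorm_ball (hd : Dense (D.domain : Set H)) (hD : IsSelfAdjoint D) :
    IsClosed {ξ | graphNorm D ξ ≤ 1} := by
  simp only [graphNorm_le_one_iff hd hD, Set.ofPred_and, Set.ofPred_forall]
  exact (isClosed_le (by fun_prop) (by fun_prop)).inter
    (isClosed_iInter fun ζ => isClosed_le (by fun_prop) (by fun_prop))

end GraphNorm

namespace SpectralTriple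

variable (T : SpectralTriple.{u})

theorem isCompact_graphNorm_ball : IsCompact {ξ | graphNorm T.D ξ ≤ 1} := by
  obtain ⟨R, hR, -, hR2⟩ := T.compact_inverse
  obtain ⟨C, hC, hRC⟩ := IsCompactOperator.image_closedBall_subset_compact
    (f := (R : T.Hil →ₗ[ℂ] T.Hil)) hR 1
  refine hC.of_isClosed_subset (isClosed_graphNorm_ball T.dense_domain T.isSelfAdjoint) ?_
  intro ξ hξ
  obtain ⟨hm, h⟩ := graphNorm_le_one_iff_real.1 hξ
  refine hRC ⟨T.D ⟨ξ, hm⟩ + Complex.I • ξ, ?_, hR2 ⟨ξ, hm⟩⟩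
  rw [mem_closedBall_zero_iff]
  refine (norm_add_le _ _).trans ?_
  rw [norm_smul, Complex.norm_I, one_mul]
  linarith

theorem exists_commutator_bound {a : T.Alg} (ha : commutatorSeminorm T.rep T.D a < ⊤)
    (ξ : T.D.domain) : ∃ h : T.rep a ξ ∈ T.D.domain,
      ‖T.D ⟨T.rep a ξ, h⟩ - T.rep a (T.D ξ)‖ₑ ≤
        commutatorSeminorm T.rep T.D a * ‖(ξ : T.Hil)‖ₑ := by
  have hex := ha
  simp only [commutatorSeminorm, iInf_lt_iff] at hex
  obtain ⟨C, hC, -⟩ := hex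
  obtain ⟨h, -⟩ := hC.2 ξ
  refine ⟨h, ?_⟩
  by_cases hξ : (ξ : T.Hil) = 0
  · obtain ⟨h', hb⟩ := hC.2 ξ
    have h0 := norm_le_zero_iff.1 (hb.trans_eq (by rw [hξ, norm_zero, mul_zero]))
    simp [h0]
  · have hξ' : ‖(ξ : T.Hil)‖ₑ ≠ 0 := by simpa using hξ
    rw [← ENNReal.div_le_iff_le_mul (Or.inl hξ') (Or.inl enorm_ne_top)]
    refine le_iInf₂ fun C' hC' => ?_
    obtain ⟨h', hb⟩ := hC'.2 ξ
    rw [ENNReal.div_le_iff_le_mul (Or.inl hξ') (Or.inl enorm_ne_top), ← ofReal_norm,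
      ← ofReal_norm, ← ENNReal.ofReal_coe_nnreal, ← ENNReal.ofReal_mul C'.coe_nonneg]
    exact ENNReal.ofReal_le_ofReal hb

theorem graphNorm_rep_le {a : T.Alg} {ξ : T.Hil} (ha : commutatorSeminorm T.rep T.D a < ⊤)
    (hξ : graphNorm T.D ξ < ⊤) : graphNorm T.D (T.rep a ξ) ≤
      (‖a‖ₑ + commutatorSeminorm T.rep T.D a) * graphNorm T.D ξ := by
  have hm := mem_domain_of_graphNorm hξ
  obtain ⟨h, hb⟩ := T.exists_commutator_bound ha ⟨ξ, hm⟩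
  have hop : ∀ η, ‖T.rep a η‖ₑ ≤ ‖a‖ₑ * ‖η‖ₑ := by
    intro η
    have h1 : ‖T.rep a η‖ ≤ ‖a‖ * ‖η‖ :=
      ((T.rep a).le_opNorm η).trans
        (mul_le_mul_of_nonneg_right (NonUnitalStarAlgHom.norm_apply_le T.rep a) (norm_nonneg _))
    rw [← ofReal_norm, ← ofReal_norm, ← ofReal_norm, ← ENNReal.ofReal_mul (norm_nonneg _)]
    exact ENNReal.ofReal_le_ofReal h1
  rw [graphNorm_of_mem hm, graphNorm_of_mem h]
  have h2 : ‖T.D ⟨T.rep a ξ, h⟩‖ₑ ≤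
      commutatorSeminorm T.rep T.D a * ‖ξ‖ₑ + ‖a‖ₑ * ‖T.D ⟨ξ, hm⟩‖ₑ := by
    calc ‖T.D ⟨T.rep a ξ, h⟩‖ₑ
        = ‖(T.D ⟨T.rep a ξ, h⟩ - T.rep a (T.D ⟨ξ, hm⟩)) + T.rep a (T.D ⟨ξ, hm⟩)‖ₑ := by
          rw [sub_add_cancel]
      _ ≤ _ := (enorm_add_le _ _).trans (add_le_add hb (hop _))
  calc ‖T.rep a ξ‖ₑ + ‖T.D ⟨T.rep a ξ, h⟩‖ₑ
      ≤ ‖a‖ₑ * ‖ξ‖ₑ +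
        (commutatorSeminorm T.rep T.D a * ‖ξ‖ₑ + ‖a‖ₑ * ‖T.D ⟨ξ, hm⟩‖ₑ) := add_le_add (hop _) h2
    _ ≤ ‖a‖ₑ * ‖ξ‖ₑ +
        (commutatorSeminorm T.rep T.D a * ‖ξ‖ₑ + ‖a‖ₑ * ‖T.D ⟨ξ, hm⟩‖ₑ) +
        commutatorSeminorm T.rep T.D a * ‖T.D ⟨ξ, hm⟩‖ₑ := le_self_add
    _ = (‖a‖ₑ + commutatorSeminorm T.rep T.D a) * (‖ξ‖ₑ + ‖T.D ⟨ξ, hm⟩‖ₑ) := by ring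

end SpectralTriple

/-- The metrical C*-correspondence `(Hil, graph norm of D, Alg, ‖[D, ·]‖, ℂ, 0)`. -/
@[reducible]
def MetricSpectralTriple.mcc (T : MetricSpectralTriple.{u} p) :
    MetricalCorrespondence.{u, u, 0} p :=
  letI := rightScalars T.Hil
  letI := hilbertSpaceModule T.Hil
  { Mod := T.Hil
    Alg := T.Alg
    Coef := ℂ
    act := T.rep.toAlgHom
    inner_act := fun a ω η => by
      change inner ℂ (T.rep a ω) η = inner ℂ ω (T.rep (star a) η)
      rw [map_star, ContinuousLinearMap.star_eq_adjoint, ContinuousLinearMap.adjoint_inner_right]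
    DN := graphNorm T.D
    L := commutatorSeminorm T.rep T.D
    S := zeroSeminorm
    quantumMetric_L := T.quantumMetric
    quantumMetric_S := zeroSeminorm_isQuantumMetric
    DN_add_le := graphNorm_add_le
    DN_smul := graphNorm_smul
    DN_dense := by
      simp only [graphNorm_lt_top_iff]
      exact T.dense_domain
    enorm_le_DN := enorm_le_graphNorm
    isCompact_DN_ball := T.isCompact_graphNorm_ball
    modular_leibniz := fun a ω ha hω => by
      refine (T.graphNorm_rep_le ha hω).trans (mul_le_mul_left ?_ _)
      exact le_mul_of_one_le_left zero_le (ENNReal.one_le_ofReal.2 p.one_le_G)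
    inner_leibniz := fun ω η _ _ => by
      rw [zeroSeminorm_of_isSelfAdjoint (ℜ _).2, zeroSeminorm_of_isSelfAdjoint (ℑ _).2]
      simp }

/-! ### Functional calculus

The operator `D` is self-adjoint with compact resolvent, so its spectral measure is the sum over
`r ∈ ℝ` of the Dirac masses at `r` with value the orthogonal projection `P_r` onto `ker (D - r)`
(zero unless `r` is one of the eigenvalues). Hence `f(D) ξ = ∑ r, f(r) • P_r ξ` for all bounded
continuous `f`. -/

namespace SpectralTriple

variable (T : SpectralTriple.{u})

/-- The space `ker (D - r)`. -/
def eigenspace (r : ℝ) : Submodule ℂ T.Hil where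
  carrier := {ξ | ∃ h : ξ ∈ T.D.domain, T.D ⟨ξ, h⟩ = (r : ℂ) • ξ}
  zero_mem' := ⟨T.D.domain.zero_mem, by
    have e : T.D ⟨0, T.D.domain.zero_mem⟩ = 0 := T.D.map_zero
    rw [e, smul_zero]⟩
  add_mem' := by
    rintro ξ η ⟨hξ, eξ⟩ ⟨hη, eη⟩
    have e : T.D ⟨ξ + η, T.D.domain.add_mem hξ hη⟩ = T.D ⟨ξ, hξ⟩ + T.D ⟨η, hη⟩ :=
      T.D.map_add ⟨ξ, hξ⟩ ⟨η, hη⟩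
    exact ⟨T.D.domain.add_mem hξ hη, by rw [e, eξ, eη, smul_add]⟩
  smul_mem' := by
    rintro c ξ ⟨hξ, eξ⟩
    have e : T.D ⟨c • ξ, T.D.domain.smul_mem c hξ⟩ = c • T.D ⟨ξ, hξ⟩ := T.D.map_smul c ⟨ξ, hξ⟩
    exact ⟨T.D.domain.smul_mem c hξ, by rw [e, eξ, smul_comm]⟩

theorem isFormalAdjoint : T.D.IsFormalAdjoint T.D := by
  have := LinearPMap.adjoint_isFormalAdjoint T.dense_domain
  rwa [LinearPMap.isSelfAdjoint_def.1 T.isSelfAdjoint] at this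

theorem isClosed_eigenspace (r : ℝ) : IsClosed (T.eigenspace r : Set T.Hil) := by
  have : (T.eigenspace r : Set T.Hil) =
      {ξ | ∀ ζ : T.D.domain, inner ℂ ((r : ℂ) • ξ) (ζ : T.Hil) = inner ℂ ξ (T.D ζ)} := by
    ext ξ
    constructor
    · rintro ⟨h, e⟩ ζ
      rw [← e]
      exact T.isFormalAdjoint ⟨ξ, h⟩ ζ
    · intro h
      have hm : ξ ∈ T.D.domain := by
        rw [← LinearPMap.isSelfAdjoint_def.1 T.isSelfAdjoint]
        exact LinearPMap.mem_adjoint_domain_of_exists _ ⟨_, h⟩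
      refine ⟨hm, T.dense_domain.eq_of_inner_left ℂ fun ζ hζ => ?_⟩
      rw [h ⟨ζ, hζ⟩]
      exact T.isFormalAdjoint ⟨ξ, hm⟩ ⟨ζ, hζ⟩
  rw [this, Set.ofPred_forall]
  exact isClosed_iInter fun ζ => isClosed_eq (by fun_prop) (by fun_prop)

instance (r : ℝ) : (T.eigenspace r).HasOrthogonalProjection :=
  haveI : CompleteSpace (T.eigenspace r) := (T.isClosed_eigenspace r).completeSpace_coe
  inferInstance

theorem orthogonalFamily_eigenspace :
    OrthogonalFamily ℂ (fun r => T.eigenspace r) fun r => (T.eigenspace r).subtypeₗᵢ := by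
  rintro r s hrs ⟨ξ, hξ, eξ⟩ ⟨η, hη, eη⟩
  have h := T.isFormalAdjoint ⟨ξ, hξ⟩ ⟨η, hη⟩
  rw [eξ, eη, inner_smul_left, inner_smul_right, Complex.conj_ofReal] at h
  have h2 : ((r : ℂ) - s) * inner ℂ ξ η = 0 := by
    rw [sub_mul, sub_eq_zero]
    exact h
  rcases mul_eq_zero.1 h2 with h3 | h3
  · exact absurd (Complex.ofReal_injective (sub_eq_zero.1 h3)) hrs
  · exact h3

/-- Bessel inequality. -/
theorem sum_norm_sq_proj_le (ξ : T.Hil) (s : Finset ℝ) :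
    ∑ r ∈ s, ‖(T.eigenspace r).starProjection ξ‖ ^ 2 ≤ ‖ξ‖ ^ 2 := by
  set y : T.Hil := ∑ r ∈ s, (T.eigenspace r).starProjection ξ with hy
  have h1 : ‖y‖ ^ 2 = ∑ r ∈ s, ‖(T.eigenspace r).starProjection ξ‖ ^ 2 :=
    T.orthogonalFamily_eigenspace.norm_sum
      (fun r => (T.eigenspace r).orthogonalProjectionOnto ξ) s
  have h2 : inner ℂ y ξ = ((∑ r ∈ s, ‖(T.eigenspace r).starProjection ξ‖ ^ 2 : ℝ) : ℂ) := by
    rw [hy, sum_inner, Complex.ofReal_sum]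
    refine Finset.sum_congr rfl fun r _ => ?_
    have h : (T.eigenspace r).starProjection ((T.eigenspace r).starProjection ξ) =
        (T.eigenspace r).starProjection ξ :=
      Submodule.starProjection_eq_self_iff.2 (Submodule.starProjection_apply_mem _ _)
    rw [← h, Submodule.inner_starProjection_left_eq_right, h, inner_self_eq_norm_sq_to_K]
    simp
  have h3 : ‖y‖ ^ 2 ≤ ‖y‖ * ‖ξ‖ := by
    have := norm_inner_le_norm (𝕜 := ℂ) y ξ
    rw [h2, ← h1, Complex.norm_real, Real.norm_of_nonneg (sq_nonneg _)] at this
    exact this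
  rw [← h1]
  nlinarith [norm_nonneg y, norm_nonneg ξ]

theorem summable_norm_sq_proj (ξ : T.Hil) :
    Summable fun r => ‖(T.eigenspace r).starProjection ξ‖ ^ 2 :=
  summable_of_sum_le (fun _ => sq_nonneg _) (T.sum_norm_sq_proj_le ξ)

theorem norm_sq_smul_proj_le (f : ℝ →ᵇ ℂ) (ξ : T.Hil) (r : ℝ) :
    ‖f r • (T.eigenspace r).orthogonalProjectionOnto ξ‖ ^ 2 ≤
      ‖f‖ ^ 2 * ‖(T.eigenspace r).starProjection ξ‖ ^ 2 := by
  rw [norm_smul, mul_pow]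
  exact mul_le_mul_of_nonneg_right (pow_le_pow_left₀ (norm_nonneg _) (f.norm_coe_le_norm r) 2)
    (sq_nonneg _)

theorem summable_calculus (f : ℝ →ᵇ ℂ) (ξ : T.Hil) :
    Summable fun r => f r • (T.eigenspace r).starProjection ξ :=
  (T.orthogonalFamily_eigenspace.summable_iff_norm_sq_summable
    (fun r => f r • (T.eigenspace r).orthogonalProjectionOnto ξ)).2
    (Summable.of_nonneg_of_le (fun _ => sq_nonneg _) (T.norm_sq_smul_proj_le f ξ)
      ((T.summable_norm_sq_proj ξ).mul_left _))

theorem norm_calculus_le (f : ℝ →ᵇ ℂ) (ξ : T.Hil) :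
    ‖∑' r : ℝ, f r • (T.eigenspace r).starProjection ξ‖ ≤ ‖f‖ * ‖ξ‖ := by
  refine le_of_tendsto (T.summable_calculus f ξ).hasSum.norm (Eventually.of_forall fun s => ?_)
  refine le_of_sq_le_sq ?_ (by positivity)
  have h1 : ‖∑ r ∈ s, f r • (T.eigenspace r).starProjection ξ‖ ^ 2 =
      ∑ r ∈ s, ‖f r • (T.eigenspace r).orthogonalProjectionOnto ξ‖ ^ 2 :=
    T.orthogonalFamily_eigenspace.norm_sum
      (fun r => f r • (T.eigenspace r).orthogonalProjectionOnto ξ) s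
  rw [h1, mul_pow]
  refine (Finset.sum_le_sum fun r _ => T.norm_sq_smul_proj_le f ξ r).trans ?_
  rw [← Finset.mul_sum]
  exact mul_le_mul_of_nonneg_left (T.sum_norm_sq_proj_le ξ s) (sq_nonneg _)

/-- The bounded operator `f(D)`, for `f` bounded and continuous. -/
def calculus (f : ℝ →ᵇ ℂ) : T.Hil →L[ℂ] T.Hil :=
  LinearMap.mkContinuous
    { toFun := fun ξ => ∑' r : ℝ, f r • (T.eigenspace r).starProjection ξ
      map_add' := fun ξ η => by
        simp only [map_add, smul_add]
        exact (T.summable_calculus f ξ).tsum_add (T.summable_calculus f η)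
      map_smul' := fun c ξ => by
        simp only [map_smul, RingHom.id_apply]
        rw [← tsum_const_smul'' c]
        simp only [smul_comm c] }
    ‖f‖ (T.norm_calculus_le f)

end SpectralTriple

/-- The function `E_t : s ↦ exp (i t s)`. -/
def expFun (t : ℝ) : ℝ →ᵇ ℂ :=
  BoundedContinuousFunction.ofNormedAddCommGroup
    (fun s : ℝ => Complex.exp (Complex.I * t * s)) (by fun_prop) 1 (fun s => by
      rw [show Complex.I * t * s = ((t * s : ℝ) : ℂ) * Complex.I by push_cast; ring,
        Complex.norm_exp_ofReal_mul_I])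

namespace MetricSpectralTriple

/-- A bounded operator of the Hilbert space of `T`, as an adjointable operator. -/
def adjointable (T : MetricSpectralTriple.{u} p) (a : T.Hil →L[ℂ] T.Hil) : T.mcc.Adjointable :=
  ⟨a, ContinuousLinearMap.adjoint a, fun ω η => (ContinuousLinearMap.adjoint_inner_right a ω η).symm⟩

/-- `U^t = exp (i t D)`. -/
def U (T : MetricSpectralTriple.{u} p) (t : ℝ) : T.Hil →L[ℂ] T.Hil := T.calculus (expFun t)

/-- The operator `U^t` as an adjointable operator. -/
def adjU (T : MetricSpectralTriple.{u} p) (t : ℝ) : T.mcc.Adjointable := T.adjointable (T.U t)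

/-- The operator `f(D)` for `f ∈ C₀(ℝ)`, as an adjointable operator. -/
def adjC0 (T : MetricSpectralTriple.{u} p) (f : C₀(ℝ, ℂ)) : T.mcc.Adjointable :=
  T.adjointable (T.calculus f.toBCF)

end MetricSpectralTriple

/-! ### The spectral propinquity -/

/-- `(ς₁, ς₂)` is an `ε`-iso-iso of `[0, ∞)`. -/
def IsIsoIso (ε : ℝ) (ς₁ ς₂ : ℝ≥0 → ℝ≥0) : Prop :=
  ς₁ 0 = 0 ∧ ς₂ 0 = 0 ∧ ∀ x y z : ℝ≥0, (x : ℝ) ≤ 1 / ε → (y : ℝ) ≤ 1 / ε → (z : ℝ) ≤ 1 / ε →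
    |(|(ς₁ x + ς₁ y - z : ℝ)| - |(x + y - ς₂ z : ℝ)|)| < ε ∧
    |(|(ς₂ x + ς₂ y - z : ℝ)| - |(x + y - ς₁ z : ℝ)|)| < ε

/-- The first half of the `ε`-reach of a tunnel between metric spectral triples. -/
def halfReach {T₁ T₂ : MetricSpectralTriple.{u} p} (τ : Tunnel T₁.mcc T₂.mcc) (ς : ℝ≥0 → ℝ≥0)
    (ε : ℝ) : ℝ≥0∞ :=
  hausdorffTo (kantorovichFamily τ.P)
    {Φ : {t : ℝ≥0 // (t : ℝ) ≤ 1 / ε} → τ.P.Mod →L[ℂ] ℂ | ∃ ξ : T₁.Hil, graphNorm T₁.D ξ ≤ 1 ∧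
      Φ = fun t => (innerSL ℂ (T₁.U (-(t.1 : ℝ)) ξ)).comp τ.fst.toMod}
    {Φ : {t : ℝ≥0 // (t : ℝ) ≤ 1 / ε} → τ.P.Mod →L[ℂ] ℂ | ∃ ξ : T₂.Hil, graphNorm T₂.D ξ ≤ 1 ∧
      Φ = fun t => (innerSL ℂ (T₂.U (-(ς t.1 : ℝ)) ξ)).comp τ.snd.toMod}

/-- The `ε`-reach. -/
def reach {T₁ T₂ : MetricSpectralTriple.{u} p} (τ : Tunnel T₁.mcc T₂.mcc) (ς₁ ς₂ : ℝ≥0 → ℝ≥0)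
    (ε : ℝ) : ℝ≥0∞ :=
  max (halfReach τ ς₁ ε) (halfReach τ.symm ς₂ ε)

/-- The `ε`-magnitude. -/
def magnitude {T₁ T₂ : MetricSpectralTriple.{u} p} (τ : Tunnel T₁.mcc T₂.mcc)
    (ς₁ ς₂ : ℝ≥0 → ℝ≥0) (ε : ℝ) : ℝ≥0∞ :=
  max τ.extent (reach τ ς₁ ς₂ ε)

/-- The spectral propinquity. -/
def spectralPropinquity (T₁ T₂ : MetricSpectralTriple.{u} p) : ℝ :=
  sInf ({√2 / 2} ∪ {ε : ℝ | 0 < ε ∧ ∃ (τ : Tunnel T₁.mcc T₂.mcc) (ς₁ ς₂ : ℝ≥0 → ℝ≥0),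
    IsIsoIso ε ς₁ ς₂ ∧ magnitude τ ς₁ ς₂ ε < ENNReal.ofReal ε})

/-- The equivalent form of the spectral propinquity obtained without iso-isos. -/
def spectralPropinquityStar (T₁ T₂ : MetricSpectralTriple.{u} p) : ℝ :=
  sInf ({√2 / 2} ∪ {ε : ℝ | 0 < ε ∧ ∃ τ : Tunnel T₁.mcc T₂.mcc,
    τ.dispersion (fun t : Set.Icc (0 : ℝ) (1 / ε) => T₁.adjU t)
      (fun t : Set.Icc (0 : ℝ) (1 / ε) => T₂.adjU t) < ENNReal.ofReal ε})

/-- The interval `[-1/(2ε), 1/(2ε)]`. -/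
abbrev symInterval (ε : ℝ) : Set ℝ := Set.Icc (-1 / (2 * ε)) (1 / (2 * ε))

/-- The symmetric `ε`-magnitude of a tunnel. -/
def symMagnitude {T₁ T₂ : MetricSpectralTriple.{u} p} (τ : Tunnel T₁.mcc T₂.mcc) (ε : ℝ) : ℝ≥0∞ :=
  τ.dispersion (fun t : symInterval ε => T₁.adjU t) (fun t : symInterval ε => T₂.adjU t)

end

end SpectralPropinquity

/-! The D-norm `‖ξ‖ + ‖D ξ‖` dominates the tails of spectral integrals. A function `h` on `ℝ` with
`‖h r‖ ≤ δ (1 + |r|)` satisfies `|⟨ξ, h(D) ζ⟩| ≤ δ (‖ξ‖ + ‖D ξ‖) ‖ζ‖`, because the factor `|r|` is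
absorbed by `D ξ`. Hence, tested against pseudo-states, `f(D)` may be replaced by a trigonometric
polynomial in `D`, that is, by a finite linear combination of the `U^t`, as soon as the polynomial
is close to `f` on a large interval and bounded outside it. For bounded continuous `f` this follows
from density of trigonometric polynomials on a circle of large circumference
(`exists_trigonometric_approximation`, `norm_inner_calculus_sub_sum_le`).

The polynomial depends on `f` and `δ` alone, not on the spectral triples. So if two vectors `ω₁`,
`ω₂` of D-norm at most `1` have close coefficients for `U^t` on a large time interval, the same two
vectors have coefficients within `δ` for `f(D₁)` and `f(D₂)`
(`exists_forall_coefficientsClose_calculus`). Keeping the pair of vectors fixed is what allows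
`f(D)` to be adjoined to the family of unitaries in the separation.

In part (1) the pairs are provided by the separation of the unitaries along the given tunnels. In
part (2) they come from the reach in the spectral propinquity: an iso-iso is within `ε` of the
identity, `t ↦ U^t` is Lipschitz against the D-norm, and a translation by half the interval turns
the times `[0, 1/ε]` into a symmetric interval (`exists_coefficientsClose_of_halfReach_lt`). -/

namespace SpectralPropinquity

/-! ### Exponentials and trigonometric approximation -/

theorem expFun_apply (t s : ℝ) : expFun t s = Complex.exp (Complex.I * t * s) := rfl

theorem norm_expFun_le (t : ℝ) : ‖expFun t‖ ≤ 1 :=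
  BoundedContinuousFunction.norm_ofNormedAddCommGroup_le _ zero_le_one _

theorem conj_expFun (t s : ℝ) : starRingEnd ℂ (expFun t s) = expFun (-t) s := by
  simp only [expFun_apply, ← Complex.exp_conj]
  simp

theorem expFun_mul_expFun (t t' s : ℝ) : expFun t s * expFun t' s = expFun (t + t') s := by
  simp only [expFun_apply, ← Complex.exp_add]
  congr 1
  push_cast
  ring

theorem norm_expFun_sub_expFun_le (t t' s : ℝ) :
    ‖expFun t s - expFun t' s‖ ≤ |t - t'| * |s| := by
  have h : expFun t s - expFun t' s =
      expFun t' s * (Complex.exp (Complex.I * ((t - t') * s : ℝ)) - 1) := by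
    simp only [expFun_apply, mul_sub, ← Complex.exp_add, mul_one]
    congr 2
    push_cast
    ring
  rw [h, norm_mul, ← abs_mul]
  exact (mul_le_of_le_one_left (norm_nonneg _)
    (((expFun t').norm_coe_le_norm s).trans (norm_expFun_le t'))).trans
    Real.norm_exp_I_mul_ofReal_sub_one_le

/-- A bounded continuous function is approximated by trigonometric polynomials, uniformly on large
intervals and with an error of at most linear growth. -/
theorem exists_trigonometric_approximation (f : ℝ →ᵇ ℂ) {δ : ℝ} (hδ : 0 < δ) :
    ∃ (s : Finset ℤ) (c : ℤ → ℂ) (t : ℤ → ℝ),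
      ∀ r : ℝ, ‖f r - ∑ k ∈ s, c k * expFun (t k) r‖ ≤ δ + δ * |r| := by
  -- Outside `[-R, R]` nothing better than the crude bound `2‖f‖ + δ` is available; `R` is chosen so
  -- that it is at most `δ |r|` there.
  obtain ⟨R, hR, hRδ⟩ : ∃ R : ℝ, 0 < R ∧ 2 * ‖f‖ + δ ≤ δ * R :=
    ⟨(2 * ‖f‖ + δ) / δ, by positivity, by rw [mul_div_cancel₀ _ hδ.ne']⟩
  have : Fact (0 < 4 * R) := ⟨by positivity⟩
  -- Reflecting `f` at `R` gives equal values `f (-R)` at both ends of `[-R, 3R]`, hence a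
  -- continuous `4R`-periodic function, still bounded by `‖f‖`, which agrees with `f` on `[-R, R]`.
  let F : ℝ → ℂ := fun x => f (min x (2 * R - x))
  have hF : Continuous (AddCircle.liftIco (4 * R) (-R) F) := by
    refine AddCircle.liftIco_continuous ?_ (Continuous.continuousOn (by fun_prop))
    simp only [F]
    rw [min_eq_left (by linarith), min_eq_right (by linarith)]
    congr 1
    ring
  have hFb : ∀ x, ‖AddCircle.liftIco (4 * R) (-R) F x‖ ≤ ‖f‖ := fun x => f.norm_coe_le_norm _
  have hmem : (⟨_, hF⟩ : C(AddCircle (4 * R), ℂ)) ∈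
      (Submodule.span ℂ (Set.range (fourier (T := 4 * R)))).topologicalClosure := by
    rw [span_fourier_closure_eq_top]
    trivial
  obtain ⟨q, hq, hqF⟩ := Metric.mem_closure_iff.1 hmem δ hδ
  obtain ⟨c, rfl⟩ := Finsupp.mem_span_range_iff_exists_finsupp.1 hq
  refine ⟨c.support, c, fun k => 2 * Real.pi * k / (4 * R), fun r => ?_⟩
  have hval : ∑ k ∈ c.support, c k * expFun (2 * Real.pi * k / (4 * R)) r =
      (c.sum fun i a => a • fourier i) (r : AddCircle (4 * R)) := by
    rw [Finsupp.sum, ContinuousMap.sum_apply]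
    refine Finset.sum_congr rfl fun k _ => ?_
    rw [ContinuousMap.smul_apply, smul_eq_mul, fourier_coe_apply, expFun_apply]
    congr 2
    push_cast
    ring
  rw [hval]
  set q := c.sum fun i a => a • fourier (T := 4 * R) i
  have h1 : ‖AddCircle.liftIco (4 * R) (-R) F r - q r‖ ≤ δ := by
    rw [← dist_eq_norm]
    exact (ContinuousMap.dist_apply_le_dist (f := ⟨_, hF⟩) (g := q) (r : AddCircle (4 * R))).trans
      hqF.le
  by_cases hr : |r| ≤ R
  · obtain ⟨hr1, hr2⟩ := abs_le.1 hr
    have h2 : AddCircle.liftIco (4 * R) (-R) F r = f r := by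
      rw [AddCircle.liftIco_coe_apply ⟨hr1, by linarith⟩]
      simp only [F]
      rw [min_eq_left (by linarith)]
    rw [h2] at h1
    exact h1.trans (le_add_of_nonneg_right (by positivity))
  · have h3 : ‖f r - q r‖ ≤ ‖f r‖ + ‖AddCircle.liftIco (4 * R) (-R) F r‖ +
        ‖AddCircle.liftIco (4 * R) (-R) F r - q r‖ := by
      refine le_trans ?_ (add_le_add_left (norm_sub_le _ _) _)
      exact (norm_sub_le_norm_sub_add_norm_sub _ _ _)
    have h4 : δ * R ≤ δ * |r| := mul_le_mul_of_nonneg_left (not_le.1 hr).le hδ.le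
    linarith [f.norm_coe_le_norm r, hFb r]

/-! ### Spectral integrals and the D-norm -/

namespace SpectralTriple

variable (T : SpectralTriple.{u})

theorem proj_idem (r : ℝ) (ξ : T.Hil) :
    (T.eigenspace r).starProjection ((T.eigenspace r).starProjection ξ) =
      (T.eigenspace r).starProjection ξ :=
  Submodule.starProjection_eq_self_iff.2 (Submodule.starProjection_apply_mem _ _)

theorem inner_proj_proj (r : ℝ) (ξ ζ : T.Hil) :
    inner ℂ ((T.eigenspace r).starProjection ξ) ((T.eigenspace r).starProjection ζ) =
      inner ℂ ξ ((T.eigenspace r).starProjection ζ) := by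
  rw [Submodule.inner_starProjection_left_eq_right, proj_idem]

/-- Matrix coefficients are integrals of `f` against the spectral measure with mass `⟨P_r ξ, P_r ζ⟩`
at `r`. The identities below follow by comparing such sums term by term, with no appeal to
completeness of the eigenvectors. -/
theorem hasSum_inner_calculus (f : ℝ →ᵇ ℂ) (ξ ζ : T.Hil) :
    HasSum (fun r => f r * inner ℂ ((T.eigenspace r).starProjection ξ)
      ((T.eigenspace r).starProjection ζ)) (inner ℂ ξ (T.calculus f ζ)) := by
  have h := (T.summable_calculus f ζ).hasSum.mapL (innerSL ℂ ξ)
  simp only [innerSL_apply_apply, inner_smul_right] at h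
  simp only [inner_proj_proj]
  exact h

/-- Eigenspaces for distinct `r` are orthogonal, so a single term of the series survives the
projection. -/
theorem proj_calculus (f : ℝ →ᵇ ℂ) (r : ℝ) (ζ : T.Hil) :
    (T.eigenspace r).starProjection (T.calculus f ζ) =
      f r • (T.eigenspace r).starProjection ζ := by
  have h := (T.summable_calculus f ζ).hasSum.mapL (T.eigenspace r).starProjection
  refine h.unique ?_
  have h2 := hasSum_single (f := fun s => (T.eigenspace r).starProjection
    (f s • (T.eigenspace s).starProjection ζ)) r fun s hs => ?_
  · simpa only [map_smul, proj_idem] using h2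
  · rw [map_smul]
    refine smul_eq_zero_of_right _ ?_
    rw [Submodule.starProjection_apply_eq_zero_iff]
    intro η hη
    exact T.orthogonalFamily_eigenspace hs.symm ⟨η, hη⟩ ⟨_, Submodule.starProjection_apply_mem _ _⟩

theorem proj_apply_D (r : ℝ) (ξ : T.D.domain) :
    (T.eigenspace r).starProjection (T.D ξ) = (r : ℂ) • (T.eigenspace r).starProjection ξ := by
  refine Submodule.eq_starProjection_of_mem_of_inner_eq_zero
    (Submodule.smul_mem _ _ (Submodule.starProjection_apply_mem _ _)) ?_
  rintro w ⟨hw, ew⟩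
  rw [inner_sub_left, T.isFormalAdjoint ξ ⟨w, hw⟩, ew, inner_smul_left, inner_smul_right,
    Complex.conj_ofReal, Submodule.inner_starProjection_left_eq_right,
    Submodule.starProjection_eq_self_iff.2 (show w ∈ T.eigenspace r from ⟨hw, ew⟩), sub_self]

theorem inner_calculus_expFun (s t : ℝ) (ξ ζ : T.Hil) :
    inner ℂ (T.calculus (expFun s) ξ) (T.calculus (expFun t) ζ) =
      inner ℂ ξ (T.calculus (expFun (t - s)) ζ) := by
  refine (T.hasSum_inner_calculus _ _ _).unique ?_
  convert T.hasSum_inner_calculus (expFun (t - s)) ξ ζ using 2 with r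
  rw [proj_calculus, inner_smul_left, conj_expFun, ← mul_assoc, expFun_mul_expFun, sub_eq_add_neg]

theorem inner_calculus_expFun_left (s : ℝ) (ξ ζ : T.Hil) :
    inner ℂ (T.calculus (expFun s) ξ) ζ = inner ℂ ξ (T.calculus (expFun (-s)) ζ) := by
  rw [← inner_conj_symm]
  refine (Complex.hasSum_conj'.2 (T.hasSum_inner_calculus (expFun s) ζ ξ)).unique ?_
  convert T.hasSum_inner_calculus (expFun (-s)) ξ ζ using 2 with r
  rw [map_mul, conj_expFun, inner_conj_symm]

/-- Since `D` is self-adjoint, it suffices to find the vector representing `η ↦ ⟨U^s ξ, D η⟩`;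
termwise, `U^s (D ξ)` does. Consequently `U^s` maps the unit ball of the D-norm into itself. -/
theorem exists_D_calculus_expFun (s : ℝ) (ξ : T.D.domain) :
    ∃ h : T.calculus (expFun s) ξ ∈ T.D.domain,
      T.D ⟨_, h⟩ = T.calculus (expFun s) (T.D ξ) := by
  have key : ∀ η : T.D.domain, inner ℂ (T.calculus (expFun s) (T.D ξ)) (η : T.Hil) =
      inner ℂ (T.calculus (expFun s) ξ) (T.D η) := by
    intro η
    rw [inner_calculus_expFun_left, inner_calculus_expFun_left]
    refine (T.hasSum_inner_calculus _ _ _).unique ?_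
    convert T.hasSum_inner_calculus (expFun (-s)) (ξ : T.Hil) (T.D η) using 2 with r
    rw [proj_apply_D, proj_apply_D, inner_smul_left, inner_smul_right, Complex.conj_ofReal]
  have hm : T.calculus (expFun s) ξ ∈ T.D.domain :=
    (congrArg LinearPMap.domain (LinearPMap.isSelfAdjoint_def.1 T.isSelfAdjoint)).le
      (LinearPMap.mem_adjoint_domain_of_exists _ ⟨_, key⟩)
  refine ⟨hm, T.dense_domain.eq_of_inner_left ℂ fun ζ hζ => ?_⟩
  rw [key ⟨ζ, hζ⟩]
  exact T.isFormalAdjoint ⟨_, hm⟩ ⟨ζ, hζ⟩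

theorem norm_calculus_expFun_le (s : ℝ) (ξ : T.Hil) : ‖T.calculus (expFun s) ξ‖ ≤ ‖ξ‖ :=
  (T.norm_calculus_le (expFun s) ξ).trans
    (mul_le_of_le_one_left (norm_nonneg _) (norm_expFun_le s))

theorem graphNorm_calculus_expFun_le_one (s : ℝ) {ξ : T.Hil} (hξ : graphNorm T.D ξ ≤ 1) :
    graphNorm T.D (T.calculus (expFun s) ξ) ≤ 1 := by
  obtain ⟨hm, h⟩ := graphNorm_le_one_iff_real.1 hξ
  obtain ⟨hm', e⟩ := T.exists_D_calculus_expFun s ⟨ξ, hm⟩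
  refine graphNorm_le_one_iff_real.2 ⟨hm', ?_⟩
  rw [e]
  linarith [T.norm_calculus_expFun_le s ξ, T.norm_calculus_expFun_le s (T.D ⟨ξ, hm⟩)]

theorem sum_norm_proj_mul_le (ξ ζ : T.Hil) (s : Finset ℝ) :
    ∑ r ∈ s, ‖(T.eigenspace r).starProjection ξ‖ * ‖(T.eigenspace r).starProjection ζ‖ ≤
      ‖ξ‖ * ‖ζ‖ :=
  (Real.sum_mul_le_sqrt_mul_sqrt s _ _).trans
    (mul_le_mul (Real.sqrt_le_iff.2 ⟨norm_nonneg _, T.sum_norm_sq_proj_le ξ s⟩)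
      (Real.sqrt_le_iff.2 ⟨norm_nonneg _, T.sum_norm_sq_proj_le ζ s⟩)
      (Real.sqrt_nonneg _) (norm_nonneg _))

/-- A bound for the spectral integrals of functions of at most linear growth. -/
theorem norm_le_of_hasSum_of_linear_growth {h : ℝ → ℂ} {a b : ℝ}
    (hb : 0 ≤ b) (hh : ∀ r, ‖h r‖ ≤ a + b * |r|) (ξ : T.D.domain) (ζ : T.Hil) {z : ℂ}
    (hz : HasSum (fun r => h r * inner ℂ ((T.eigenspace r).starProjection (ξ : T.Hil))
      ((T.eigenspace r).starProjection ζ)) z) :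
    ‖z‖ ≤ (a * ‖(ξ : T.Hil)‖ + b * ‖T.D ξ‖) * ‖ζ‖ := by
  have ha : 0 ≤ a := by simpa using (norm_nonneg _).trans (hh 0)
  refine le_of_tendsto hz.norm (Eventually.of_forall fun s => ?_)
  calc _ ≤ ∑ r ∈ s, (a * (‖(T.eigenspace r).starProjection (ξ : T.Hil)‖ *
          ‖(T.eigenspace r).starProjection ζ‖) +
        b * (‖(T.eigenspace r).starProjection (T.D ξ)‖ *
          ‖(T.eigenspace r).starProjection ζ‖)) := by
        refine norm_sum_le_of_le _ fun r _ => ?_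
        -- As `P_r (D ξ) = r • P_r ξ`, the factor `|r|` of the growth bound is exactly the passage
        -- from `ξ` to `D ξ`.
        rw [norm_mul, proj_apply_D, norm_smul, Complex.norm_real, Real.norm_eq_abs]
        refine (mul_le_mul (hh r) (norm_inner_le_norm _ _) (norm_nonneg _)
          ((norm_nonneg _).trans (hh r))).trans_eq ?_
        ring
    _ ≤ a * (‖(ξ : T.Hil)‖ * ‖ζ‖) + b * (‖T.D ξ‖ * ‖ζ‖) := by
        rw [Finset.sum_add_distrib, ← Finset.mul_sum, ← Finset.mul_sum]
        exact add_le_add (mul_le_mul_of_nonneg_left (T.sum_norm_proj_mul_le _ _ s) ha)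
          (mul_le_mul_of_nonneg_left (T.sum_norm_proj_mul_le _ _ s) hb)
    _ = _ := by ring

/-- The difference is the spectral integral of a function bounded by `δ (1 + |r|)`, so it costs `δ`
times the D-norm of `ξ`. Only the norm of `ζ` enters. -/
theorem norm_inner_calculus_sub_sum_le {f : ℝ →ᵇ ℂ} {s : Finset ℤ} {c : ℤ → ℂ} {t : ℤ → ℝ} {δ : ℝ}
    (hδ : 0 ≤ δ) (hf : ∀ r : ℝ, ‖f r - ∑ k ∈ s, c k * expFun (t k) r‖ ≤ δ + δ * |r|)
    {ξ ζ : T.Hil} (hξ : graphNorm T.D ξ ≤ 1) (hζ : ‖ζ‖ ≤ 1) :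
    ‖inner ℂ ξ (T.calculus f ζ) - ∑ k ∈ s, c k * inner ℂ ξ (T.calculus (expFun (t k)) ζ)‖ ≤ δ := by
  obtain ⟨hm, h⟩ := graphNorm_le_one_iff_real.1 hξ
  have hsum := (T.hasSum_inner_calculus f ξ ζ).sub
    (hasSum_sum fun k (_ : k ∈ s) => (T.hasSum_inner_calculus (expFun (t k)) ξ ζ).mul_left (c k))
  simp only [← mul_assoc, ← Finset.sum_mul, ← sub_mul] at hsum
  refine (T.norm_le_of_hasSum_of_linear_growth hδ hf ⟨ξ, hm⟩ ζ hsum).trans ?_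
  rw [← mul_add, mul_assoc]
  exact mul_le_of_le_one_right hδ (mul_le_one₀ h (norm_nonneg _) hζ)

/-- The bound `|e^{isr} - e^{itr}| ≤ |s - t| |r|` has no constant term, so only `‖D ξ‖` contributes.
This serves to replace the times `ς r` of an iso-iso by `r`. -/
theorem norm_inner_calculus_expFun_sub_le (s t : ℝ) {ξ ζ : T.Hil} (hξ : graphNorm T.D ξ ≤ 1)
    (hζ : ‖ζ‖ ≤ 1) :
    ‖inner ℂ ξ (T.calculus (expFun s) ζ) - inner ℂ ξ (T.calculus (expFun t) ζ)‖ ≤ |s - t| := by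
  obtain ⟨hm, h⟩ := graphNorm_le_one_iff_real.1 hξ
  have hsum := (T.hasSum_inner_calculus (expFun s) ξ ζ).sub
    (T.hasSum_inner_calculus (expFun t) ξ ζ)
  simp only [← sub_mul] at hsum
  refine (T.norm_le_of_hasSum_of_linear_growth (a := 0) (abs_nonneg (s - t))
    (fun r => by simpa using norm_expFun_sub_expFun_le s t r) ⟨ξ, hm⟩ ζ hsum).trans ?_
  rw [zero_mul, zero_add, mul_assoc]
  refine mul_le_of_le_one_right (abs_nonneg _) (mul_le_one₀ ?_ (norm_nonneg _) hζ)
  linarith [norm_nonneg ξ]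

end SpectralTriple

/-! ### Quotient D-norms, Hausdorff and Kantorovich distances, pseudo-states -/

variable {p : LeibnizParams}

theorem ModularQuantumIsometry.DN_toMod_le {M₁ : MetricalCorrespondence.{u, v, w} p}
    {M₂ : MetricalCorrespondence.{u, v, w'} p} (Φ : ModularQuantumIsometry M₁ M₂) {x : M₁.Mod}
    (hx : M₁.DN x < ⊤) : M₂.DN (Φ.toMod x) ≤ M₁.DN x := by
  rw [Φ.DN_eq _ (Φ.map_dom_DN x hx)]
  exact sInf_le ⟨x, ⟨hx, rfl⟩, rfl⟩

theorem ModularQuantumIsometry.norm_toMod_le_one {M₁ : MetricalCorrespondence.{u, v, w} p}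
    {M₂ : MetricalCorrespondence.{u, v, w'} p} (Φ : ModularQuantumIsometry M₁ M₂) {x : M₁.Mod}
    (hx : M₁.DN x ≤ 1) : ‖Φ.toMod x‖ ≤ 1 := by
  have h := (M₂.enorm_le_DN _).trans ((Φ.DN_toMod_le (hx.trans_lt ENNReal.one_lt_top)).trans hx)
  rwa [← ofReal_norm, ENNReal.ofReal_le_one] at h

theorem hausdorffTo_le {X : Type*} {d : X → X → ℝ≥0∞} {A B : Set X} {δ : ℝ≥0∞}
    (h : ∀ x ∈ A, ∃ y ∈ B, d x y ≤ δ) : hausdorffTo d A B ≤ δ :=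
  iSup₂_le fun x hx => let ⟨y, hy, hxy⟩ := h x hx; (iInf₂_le y hy).trans hxy

theorem exists_of_hausdorffTo_lt {X : Type*} {d : X → X → ℝ≥0∞} {A B : Set X} {δ : ℝ≥0∞}
    (h : hausdorffTo d A B < δ) {x : X} (hx : x ∈ A) : ∃ y ∈ B, d x y < δ := by
  have h' := (le_iSup₂ (f := fun x (_ : x ∈ A) => ⨅ y ∈ B, d x y) x hx).trans_lt h
  simpa only [iInf_lt_iff, exists_prop] using h'

theorem kantorovich_le_ofReal {E : Type*} {N : E → ℝ≥0∞} {φ ψ : E → ℂ} {δ : ℝ}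
    (h : ∀ x, N x ≤ 1 → ‖φ x - ψ x‖ ≤ δ) : kantorovich N φ ψ ≤ ENNReal.ofReal δ :=
  iSup₂_le fun x hx => by
    rw [← ofReal_norm]
    exact ENNReal.ofReal_le_ofReal (h x hx)

theorem norm_sub_le_of_kantorovich_le {E : Type*} {N : E → ℝ≥0∞} {φ ψ : E → ℂ} {δ : ℝ}
    (hδ : 0 ≤ δ) (h : kantorovich N φ ψ ≤ ENNReal.ofReal δ) {x : E} (hx : N x ≤ 1) :
    ‖φ x - ψ x‖ ≤ δ := by
  have h' := (le_iSup₂ (f := fun x (_ : N x ≤ 1) => ‖φ x - ψ x‖ₑ) x hx).trans h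
  rwa [← ofReal_norm, ENNReal.ofReal_le_ofReal_iff hδ] at h'

theorem mem_pseudoStates_mcc_iff {T : MetricSpectralTriple.{u} p} {φ : T.mcc.Mod →L[ℂ] ℂ} :
    φ ∈ T.mcc.pseudoStates ↔
      ∃ ω : T.Hil, graphNorm T.D ω ≤ 1 ∧ ∀ ξ : T.Hil, φ ξ = inner ℂ ω ξ := by
  constructor
  · rintro ⟨μ, hμ, ω, hω, h⟩
    refine ⟨ω, hω, fun ξ => ?_⟩
    -- By linearity and `μ 1 = 1`, the identity is the only state of `ℂ`.
    have hid : ∀ z : ℂ, μ z = z := fun z => by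
      have e : μ (z • (1 : ℂ)) = z • μ 1 := map_smul μ z 1
      rw [hμ.1] at e
      simpa using e
    exact (h ξ).trans (hid _)
  · rintro ⟨ω, hω, h⟩
    exact ⟨ContinuousLinearMap.id ℂ ℂ, ⟨rfl, fun a => star_mul_self_nonneg a⟩, ω, hω, h⟩

/-! ### Separation in terms of matrix coefficients -/

variable {T₁ T₂ : MetricSpectralTriple.{u} p}

/-- The matrix coefficients of `a₁` and `a₂`, at the vectors `ω₁` and `ω₂` and along the unit ball of
the D-norm of the tunnel, are at a distance at most `δ`. -/
def Tunnel.CoefficientsClose (τ : Tunnel T₁.mcc T₂.mcc) (ω₁ : T₁.Hil) (ω₂ : T₂.Hil)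
    (a₁ : T₁.Hil →L[ℂ] T₁.Hil) (a₂ : T₂.Hil →L[ℂ] T₂.Hil) (δ : ℝ) : Prop :=
  ∀ x, τ.P.DN x ≤ 1 →
    ‖inner ℂ ω₁ (a₁ (τ.fst.toMod x)) - inner ℂ ω₂ (a₂ (τ.snd.toMod x))‖ ≤ δ

theorem Tunnel.separation_symm (τ : Tunnel T₁.mcc T₂.mcc) {J : Type*} (a₁ : J → T₁.mcc.Adjointable)
    (a₂ : J → T₂.mcc.Adjointable) : τ.symm.separation a₂ a₁ = τ.separation a₁ a₂ :=
  max_comm _ _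

/-- An upper bound for the separation, in terms of the vectors defining the pseudo-states. -/
theorem Tunnel.separation_le (τ : Tunnel T₁.mcc T₂.mcc) {J : Type*}
    (a₁ : J → T₁.Hil →L[ℂ] T₁.Hil) (a₂ : J → T₂.Hil →L[ℂ] T₂.Hil) {δ : ℝ}
    (h₁ : ∀ ω₁ : T₁.Hil, graphNorm T₁.D ω₁ ≤ 1 → ∃ ω₂ : T₂.Hil, graphNorm T₂.D ω₂ ≤ 1 ∧
      ∀ j, τ.CoefficientsClose ω₁ ω₂ (a₁ j) (a₂ j) δ)
    (h₂ : ∀ ω₂ : T₂.Hil, graphNorm T₂.D ω₂ ≤ 1 → ∃ ω₁ : T₁.Hil, graphNorm T₁.D ω₁ ≤ 1 ∧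
      ∀ j, τ.symm.CoefficientsClose ω₂ ω₁ (a₂ j) (a₁ j) δ) :
    τ.separation (fun j => T₁.adjointable (a₁ j)) (fun j => T₂.adjointable (a₂ j)) ≤
      ENNReal.ofReal δ := by
  refine max_le (hausdorffTo_le ?_) (hausdorffTo_le ?_)
  · rintro _ ⟨φ, hφ, rfl⟩
    obtain ⟨ω₁, hω₁, e₁⟩ := mem_pseudoStates_mcc_iff.1 hφ
    obtain ⟨ω₂, hω₂, h⟩ := h₁ ω₁ hω₁
    refine ⟨_, ⟨innerSL ℂ ω₂, mem_pseudoStates_mcc_iff.2 ⟨ω₂, hω₂, fun _ => rfl⟩, rfl⟩,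
      iSup_le fun j => kantorovich_le_ofReal fun x hx => ?_⟩
    refine le_trans (le_of_eq ?_) (h j x hx)
    exact congrArg (fun z : ℂ => ‖z - inner ℂ ω₂ (a₂ j (τ.snd.toMod x))‖) (e₁ _)
  · rintro _ ⟨φ, hφ, rfl⟩
    obtain ⟨ω₂, hω₂, e₂⟩ := mem_pseudoStates_mcc_iff.1 hφ
    obtain ⟨ω₁, hω₁, h⟩ := h₂ ω₂ hω₂
    refine ⟨_, ⟨innerSL ℂ ω₁, mem_pseudoStates_mcc_iff.2 ⟨ω₁, hω₁, fun _ => rfl⟩, rfl⟩,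
      iSup_le fun j => kantorovich_le_ofReal fun x hx => ?_⟩
    refine le_trans (le_of_eq ?_) (h j x hx)
    exact congrArg (fun z : ℂ => ‖z - inner ℂ ω₁ (a₁ j (τ.fst.toMod x))‖) (e₂ _)

/-- Partial converse of `separation_le`. The inequality is strict because the infimum in the
Hausdorff distance need not be attained. -/
theorem Tunnel.exists_coefficientsClose_of_separation_lt (τ : Tunnel T₁.mcc T₂.mcc) {J : Type*}
    {a₁ : J → T₁.Hil →L[ℂ] T₁.Hil} {a₂ : J → T₂.Hil →L[ℂ] T₂.Hil} {δ : ℝ} (hδ : 0 ≤ δ)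
    (h : τ.separation (fun j => T₁.adjointable (a₁ j)) (fun j => T₂.adjointable (a₂ j)) <
      ENNReal.ofReal δ) {ω₁ : T₁.Hil} (hω₁ : graphNorm T₁.D ω₁ ≤ 1) :
    ∃ ω₂ : T₂.Hil, graphNorm T₂.D ω₂ ≤ 1 ∧
      ∀ j, τ.CoefficientsClose ω₁ ω₂ (a₁ j) (a₂ j) δ := by
  obtain ⟨_, ⟨ψ, hψ, rfl⟩, hd⟩ := exists_of_hausdorffTo_lt ((le_max_left _ _).trans_lt h)
    ⟨innerSL ℂ ω₁, mem_pseudoStates_mcc_iff.2 ⟨ω₁, hω₁, fun _ => rfl⟩, rfl⟩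
  obtain ⟨ω₂, hω₂, e₂⟩ := mem_pseudoStates_mcc_iff.1 hψ
  refine ⟨ω₂, hω₂, fun j x hx => ?_⟩
  refine le_trans (le_of_eq ?_)
    (norm_sub_le_of_kantorovich_le hδ ((le_iSup _ j).trans hd.le) hx)
  exact congrArg (fun z : ℂ => ‖inner ℂ ω₁ (a₁ j (τ.fst.toMod x)) - z‖) (e₂ _).symm

/-- Closeness of the unitary groups on a large interval implies closeness of `f(D₁)` and `f(D₂)`. -/
theorem exists_forall_coefficientsClose_calculus (f : ℝ →ᵇ ℂ) {δ : ℝ} (hδ : 0 < δ) :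
    ∃ N η : ℝ, 0 < η ∧ ∀ (T₁ T₂ : MetricSpectralTriple.{u} p) (τ : Tunnel T₁.mcc T₂.mcc)
      (ω₁ : T₁.Hil) (ω₂ : T₂.Hil), graphNorm T₁.D ω₁ ≤ 1 → graphNorm T₂.D ω₂ ≤ 1 →
      (∀ t, |t| ≤ N → τ.CoefficientsClose ω₁ ω₂ (T₁.U t) (T₂.U t) η) →
      τ.CoefficientsClose ω₁ ω₂ (T₁.calculus f) (T₂.calculus f) δ := by
  have hδ3 : 0 < δ / 3 := by positivity
  obtain ⟨s, c, t, hf⟩ := exists_trigonometric_approximation f hδ3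
  have hS : 0 ≤ ∑ k ∈ s, ‖c k‖ := Finset.sum_nonneg fun _ _ => norm_nonneg _
  -- The sum bounds every frequency `|t k|` at once. The `+ 1` keeps the denominator positive when
  -- all coefficients vanish; the polynomial part then differs by at most `δ / 3`, as does each of
  -- the two approximation errors.
  refine ⟨∑ k ∈ s, |t k|, δ / 3 / (∑ k ∈ s, ‖c k‖ + 1), by positivity, ?_⟩
  intro T₁ T₂ τ ω₁ ω₂ hω₁ hω₂ h x hx
  set x₁ : T₁.Hil := τ.fst.toMod x
  set x₂ : T₂.Hil := τ.snd.toMod x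
  have h₁ := T₁.norm_inner_calculus_sub_sum_le hδ3.le hf hω₁ (τ.fst.norm_toMod_le_one hx)
  have h₂ := T₂.norm_inner_calculus_sub_sum_le hδ3.le hf hω₂ (τ.snd.norm_toMod_le_one hx)
  have h₃ : ‖∑ k ∈ s, c k * inner ℂ ω₁ (T₁.calculus (expFun (t k)) x₁) -
      ∑ k ∈ s, c k * inner ℂ ω₂ (T₂.calculus (expFun (t k)) x₂)‖ ≤ δ / 3 := by
    rw [← Finset.sum_sub_distrib]
    calc _ ≤ ∑ k ∈ s, ‖c k‖ * (δ / 3 / (∑ k ∈ s, ‖c k‖ + 1)) := by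
          refine norm_sum_le_of_le _ fun k hk => ?_
          rw [← mul_sub, norm_mul]
          exact mul_le_mul_of_nonneg_left (h (t k)
            (Finset.single_le_sum (f := fun k => |t k|) (fun _ _ => abs_nonneg _) hk) x hx) (norm_nonneg _)
      _ ≤ δ / 3 := by
          rw [← Finset.sum_mul, mul_div_assoc', div_le_iff₀ (by positivity)]
          nlinarith
  have e : inner ℂ ω₁ (T₁.calculus f x₁) - inner ℂ ω₂ (T₂.calculus f x₂) =
      (inner ℂ ω₁ (T₁.calculus f x₁) -
        ∑ k ∈ s, c k * inner ℂ ω₁ (T₁.calculus (expFun (t k)) x₁)) +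
      (∑ k ∈ s, c k * inner ℂ ω₁ (T₁.calculus (expFun (t k)) x₁) -
        ∑ k ∈ s, c k * inner ℂ ω₂ (T₂.calculus (expFun (t k)) x₂)) -
      (inner ℂ ω₂ (T₂.calculus f x₂) -
        ∑ k ∈ s, c k * inner ℂ ω₂ (T₂.calculus (expFun (t k)) x₂)) := by ring
  rw [e]
  refine (norm_sub_le _ _).trans ?_
  have h₄ := norm_add_le (inner ℂ ω₁ (T₁.calculus f x₁) -
        ∑ k ∈ s, c k * inner ℂ ω₁ (T₁.calculus (expFun (t k)) x₁))
      (∑ k ∈ s, c k * inner ℂ ω₁ (T₁.calculus (expFun (t k)) x₁) -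
        ∑ k ∈ s, c k * inner ℂ ω₂ (T₂.calculus (expFun (t k)) x₂))
  linarith

/-! ### From the reach to unitary groups on a symmetric interval -/

theorem IsIsoIso.symm {ε : ℝ} {ς₁ ς₂ : ℝ≥0 → ℝ≥0} (h : IsIsoIso ε ς₁ ς₂) : IsIsoIso ε ς₂ ς₁ :=
  ⟨h.2.1, h.1, fun x y z hx hy hz => (h.2.2 x y z hx hy hz).symm⟩

theorem IsIsoIso.abs_sub_lt {ε : ℝ} {ς₁ ς₂ : ℝ≥0 → ℝ≥0} (hε : 0 < ε) (h : IsIsoIso ε ς₁ ς₂)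
    {x : ℝ≥0} (hx : (x : ℝ) ≤ 1 / ε) : |(ς₁ x - x : ℝ)| < ε := by
  have h0 : ((0 : ℝ≥0) : ℝ) ≤ 1 / ε := by simpa using hε.le
  -- With `y = z = 0` the iso-iso inequality reduces to `|ς₁ x - x| < ε`.
  have h1 := (h.2.2 x 0 0 hx h0 h0).1
  simpa [h.1, h.2.1] using h1

/-- The reach sees only times in `[0, 1/ε]`. It is applied to `U^s ω₁` with `s = 1/(2ε)`, which is
allowed because `U^s` preserves the D-ball; time `t + s` for this vector is time `t` for `ω₁`. The
error `2ε` is `ε` from the reach plus `ε` from replacing `ς r` by `r`. -/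
theorem Tunnel.exists_coefficientsClose_of_halfReach_lt (τ : Tunnel T₁.mcc T₂.mcc) {ε : ℝ}
    (hε : 0 < ε) {ς : ℝ≥0 → ℝ≥0} (hς : ∀ x : ℝ≥0, (x : ℝ) ≤ 1 / ε → |(ς x - x : ℝ)| < ε)
    (h : halfReach τ ς ε < ENNReal.ofReal ε) {ω₁ : T₁.Hil} (hω₁ : graphNorm T₁.D ω₁ ≤ 1) :
    ∃ ω₂ : T₂.Hil, graphNorm T₂.D ω₂ ≤ 1 ∧
      ∀ t, |t| ≤ 1 / (2 * ε) → τ.CoefficientsClose ω₁ ω₂ (T₁.U t) (T₂.U t) (2 * ε) := by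
  set s : ℝ := 1 / (2 * ε)
  obtain ⟨_, ⟨ξ, hξ, rfl⟩, hd⟩ := exists_of_hausdorffTo_lt h
    ⟨T₁.U s ω₁, T₁.graphNorm_calculus_expFun_le_one s hω₁, rfl⟩
  -- The shift is undone on the other side: `⟨U^{-s} ξ, U^t x₂⟩ = ⟨ξ, U^{t+s} x₂⟩`.
  refine ⟨T₂.U (-s) ξ, T₂.graphNorm_calculus_expFun_le_one _ hξ, fun t ht x hx => ?_⟩
  obtain ⟨ht1, ht2⟩ := abs_le.1 ht
  have hs : 2 * s = 1 / ε := by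
    simp only [s]
    field_simp
  let r : ℝ≥0 := ⟨t + s, by linarith⟩
  have hr : (r : ℝ) ≤ 1 / ε := by
    change t + s ≤ 1 / ε
    linarith
  have h1 := norm_sub_le_of_kantorovich_le hε.le
    ((le_iSup _ (⟨r, hr⟩ : {t : ℝ≥0 // (t : ℝ) ≤ 1 / ε})).trans hd.le) hx
  have h2 := T₂.norm_inner_calculus_expFun_sub_le (ς r) r hξ (τ.snd.norm_toMod_le_one hx)
  have h3 := (hς r hr).le
  set x₁ : T₁.Hil := τ.fst.toMod x
  set x₂ : T₂.Hil := τ.snd.toMod x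
  change ‖inner ℂ (T₁.calculus (expFun (-(r : ℝ))) (T₁.calculus (expFun s) ω₁)) x₁ -
    inner ℂ (T₂.calculus (expFun (-(ς r : ℝ))) ξ) x₂‖ ≤ ε at h1
  change ‖inner ℂ ω₁ (T₁.calculus (expFun t) x₁) -
    inner ℂ (T₂.calculus (expFun (-s)) ξ) (T₂.calculus (expFun t) x₂)‖ ≤ 2 * ε
  -- This brings the reach estimate to the form `‖⟨ω₁, U^t x₁⟩ - ⟨ξ, U^{ς r} x₂⟩‖ ≤ ε`.
  rw [SpectralTriple.inner_calculus_expFun_left, neg_neg,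
    SpectralTriple.inner_calculus_expFun, SpectralTriple.inner_calculus_expFun_left, neg_neg,
    show (r : ℝ) - s = t from add_sub_cancel_right t s] at h1
  rw [SpectralTriple.inner_calculus_expFun, sub_neg_eq_add]
  refine (norm_sub_le_norm_sub_add_norm_sub _
    (inner ℂ ξ (T₂.calculus (expFun (ς r : ℝ)) x₂)) _).trans ?_
  change ‖_ - inner ℂ ξ (T₂.calculus (expFun (t + s)) x₂)‖ ≤ _ at h2
  linarith

/-! ### Convergence of the functional calculus -/

theorem spectralPropinquityStar_nonneg (T₁ T₂ : MetricSpectralTriple.{u} p) :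
    0 ≤ spectralPropinquityStar T₁ T₂ := by
  refine Real.sInf_nonneg ?_
  rintro x (rfl | hx)
  · positivity
  · exact hx.1.le

theorem tendsto_separation_calculus (T : ℕ → MetricSpectralTriple.{u} p)
    (T' : MetricSpectralTriple.{u} p) (μ : ℕ → ℝ) (τ : ∀ n, Tunnel (T n).mcc T'.mcc)
    (hpos : ∀ n, 0 < μ n) (hmag : ∀ n, symMagnitude (τ n) (μ n) ≤ ENNReal.ofReal (μ n))
    (hμ : Tendsto μ atTop (𝓝 0)) (f : ℝ →ᵇ ℂ) :
    Tendsto (fun n => (τ n).separation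
        (Sum.elim (fun t : symInterval (μ n) => (T n).adjU t)
          (fun _ : Unit => (T n).adjointable ((T n).calculus f)))
        (Sum.elim (fun t : symInterval (μ n) => T'.adjU t)
          (fun _ : Unit => T'.adjointable (T'.calculus f)))) atTop (𝓝 0) := by
  -- Doubling `μ n` makes the bound strict, as needed to extract a vector from the infimum.
  have hsep : ∀ n, (τ n).separation
      (fun t : symInterval (μ n) => (T n).adjointable ((T n).U t))
      (fun t : symInterval (μ n) => T'.adjointable (T'.U t)) < ENNReal.ofReal (2 * μ n) := fun n =>
    ((le_max_right _ _).trans (hmag n)).trans_lt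
      ((ENNReal.ofReal_lt_ofReal_iff (by linarith [hpos n])).2 (by linarith [hpos n]))
  refine ENNReal.tendsto_nhds_zero.2 fun δ' hδ' => ?_
  obtain ⟨δ, hδ, hδδ'⟩ : ∃ δ : ℝ, 0 < δ ∧ ENNReal.ofReal δ ≤ δ' := by
    obtain ⟨q, hq0, hq⟩ := ENNReal.lt_iff_exists_nnreal_btwn.1 hδ'
    exact ⟨q, by simpa using hq0, by simpa using hq.le⟩
  obtain ⟨N, η, hη, key⟩ := exists_forall_coefficientsClose_calculus (p := p) f hδ
  have hN : ∀ᶠ n in atTop, N ≤ 1 / (2 * μ n) := by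
    have h : Tendsto (fun n => 2 * μ n) atTop (𝓝[>] 0) :=
      tendsto_nhdsWithin_iff.2 ⟨by simpa using hμ.const_mul 2,
        Eventually.of_forall fun n => mul_pos two_pos (hpos n)⟩
    simpa only [one_div, Pi.inv_apply] using h.inv_tendsto_nhdsGT_zero.eventually_ge_atTop N
  have hsmall : ∀ᶠ n in atTop, 2 * μ n ≤ min η δ := by
    have h : Tendsto (fun n => 2 * μ n) atTop (𝓝 0) := by simpa using hμ.const_mul 2
    exact (h.eventually_lt_const (lt_min hη hδ)).mono fun _ => le_of_lt
  filter_upwards [hN, hsmall] with n hNn hn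
  refine le_trans ?_ hδδ'
  have e : ∀ S : MetricSpectralTriple.{u} p,
      Sum.elim (fun t : symInterval (μ n) => S.adjU t)
        (fun _ : Unit => S.adjointable (S.calculus f)) =
      fun j => S.adjointable
        (Sum.elim (fun t : symInterval (μ n) => S.U t) (fun _ : Unit => S.calculus f) j) := by
    intro S
    ext (j | j) <;> rfl
  -- Stated for an arbitrary tunnel so that it applies to `τ n` and to its inverse, giving the two
  -- halves of the Hausdorff distance.
  have close : ∀ (S S' : MetricSpectralTriple.{u} p) (σ : Tunnel S.mcc S'.mcc) (ω : S.Hil),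
      graphNorm S.D ω ≤ 1 →
      σ.separation (fun t : symInterval (μ n) => S.adjointable (S.U t))
        (fun t : symInterval (μ n) => S'.adjointable (S'.U t)) < ENNReal.ofReal (2 * μ n) →
      ∃ ω' : S'.Hil, graphNorm S'.D ω' ≤ 1 ∧ ∀ j, σ.CoefficientsClose ω ω'
        (Sum.elim (fun t : symInterval (μ n) => S.U t) (fun _ : Unit => S.calculus f) j)
        (Sum.elim (fun t : symInterval (μ n) => S'.U t) (fun _ : Unit => S'.calculus f) j) δ := by
    intro S S' σ ω hω hσ
    obtain ⟨ω', hω', h⟩ :=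
      σ.exists_coefficientsClose_of_separation_lt (by linarith [hpos n]) hσ hω
    refine ⟨ω', hω', ?_⟩
    rintro (j | _)
    · exact fun x hx => (h j x hx).trans (hn.trans (min_le_right _ _))
    -- The vector `ω'` obtained from the unitaries alone also serves for `f(D)`.
    · refine key S S' σ ω ω' hω hω' fun t ht x hx => ?_
      have ht' : t ∈ symInterval (μ n) := by
        rw [symInterval, neg_div]
        exact abs_le.1 (ht.trans hNn)
      exact (h ⟨t, ht'⟩ x hx).trans (hn.trans (min_le_left _ _))
  rw [e, e]
  refine (τ n).separation_le _ _ (fun ω₁ hω₁ => close _ _ _ ω₁ hω₁ (hsep n))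
    (fun ω₂ hω₂ => close _ _ _ ω₂ hω₂ ?_)
  rw [Tunnel.separation_symm]
  exact hsep n

theorem tendsto_operationalPropinquity_calculus (T : ℕ → MetricSpectralTriple.{u} p)
    (T' : MetricSpectralTriple.{u} p)
    (hconv : Tendsto (fun n => spectralPropinquity (T n) T') atTop (𝓝 0)) (f : ℝ →ᵇ ℂ) :
    Tendsto (fun n => operationalPropinquity
      (fun _ : Unit => (T n).adjointable ((T n).calculus f))
      (fun _ : Unit => T'.adjointable (T'.calculus f))) atTop (𝓝 0) := by
  refine ENNReal.tendsto_nhds_zero.2 fun δ' hδ' => ?_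
  obtain ⟨δ, hδ, hδδ'⟩ : ∃ δ : ℝ, 0 < δ ∧ ENNReal.ofReal δ ≤ δ' := by
    obtain ⟨q, hq0, hq⟩ := ENNReal.lt_iff_exists_nnreal_btwn.1 hδ'
    exact ⟨q, by simpa using hq0, by simpa using hq.le⟩
  obtain ⟨N, η, hη, key⟩ := exists_forall_coefficientsClose_calculus (p := p) f hδ
  -- For `ε < κ`: the bound `√2 / 2` excludes the default value of the propinquity, `δ` controls the
  -- extent, `η` the error `2ε` on the unitaries, and the last bound gives `N ≤ 1 / (2ε)`, with `|N|
  -- + 1` positive whatever the sign of `N`.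
  obtain ⟨κ, hκ, hκ2, hκδ, hκη, hκN⟩ : ∃ κ : ℝ, 0 < κ ∧ κ ≤ √2 / 2 ∧ κ ≤ δ ∧ 2 * κ ≤ η ∧
      κ ≤ 1 / (2 * (|N| + 1)) := by
    refine ⟨min (min (√2 / 2) δ) (min (η / 2) (1 / (2 * (|N| + 1)))), by positivity, ?_, ?_, ?_, ?_⟩
    · exact (min_le_left _ _).trans (min_le_left _ _)
    · exact (min_le_left _ _).trans (min_le_right _ _)
    · linarith [(min_le_right (min (√2 / 2) δ) (min (η / 2) (1 / (2 * (|N| + 1))))).trans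
        (min_le_left _ _)]
    · exact (min_le_right _ _).trans (min_le_right _ _)
  filter_upwards [hconv.eventually_lt_const hκ] with n hn
  obtain ⟨ε, hmem, hεκ⟩ := exists_lt_of_csInf_lt ⟨√2 / 2, Or.inl rfl⟩ hn
  obtain rfl | ⟨hε, τ, ς₁, ς₂, hς, hmag⟩ := hmem
  · exact absurd hεκ (not_lt.2 hκ2)
  have hNε : N ≤ 1 / (2 * ε) := by
    have h1 : ε ≤ 1 / (2 * (|N| + 1)) := hεκ.le.trans hκN
    rw [le_div_iff₀ (by positivity)] at h1 ⊢
    nlinarith [le_abs_self N]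
  have close : ∀ (S S' : MetricSpectralTriple.{u} p) (σ : Tunnel S.mcc S'.mcc)
      (ς ς' : ℝ≥0 → ℝ≥0) (ω : S.Hil), IsIsoIso ε ς ς' → graphNorm S.D ω ≤ 1 →
      halfReach σ ς ε < ENNReal.ofReal ε → ∃ ω' : S'.Hil, graphNorm S'.D ω' ≤ 1 ∧
        ∀ _ : Unit, σ.CoefficientsClose ω ω' (S.calculus f) (S'.calculus f) δ := by
    intro S S' σ ς ς' ω hς hω hσ
    obtain ⟨ω', hω', h⟩ := σ.exists_coefficientsClose_of_halfReach_lt hε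
      (fun _ hx => hς.abs_sub_lt hε hx) hσ hω
    exact ⟨ω', hω', fun _ => key S S' σ ω ω' hω hω' fun t ht x hx =>
      (h t (ht.trans hNε) x hx).trans (by linarith)⟩
  have hreach := (le_max_right _ _).trans_lt hmag
  refine (iInf_le _ τ).trans (le_trans (max_le ?_ ?_) hδδ')
  -- The dispersion also involves the extent, which is below the magnitude, hence below `ε < κ ≤ δ`.
  · exact ((le_max_left _ _).trans hmag.le).trans (ENNReal.ofReal_le_ofReal (hεκ.le.trans hκδ))
  · exact τ.separation_le _ _
      (fun ω₁ hω₁ => close _ _ _ _ _ ω₁ hς hω₁ ((le_max_left _ _).trans_lt hreach))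
      (fun ω₂ hω₂ => close _ _ _ _ _ ω₂ hς.symm hω₂ ((le_max_right _ _).trans_lt hreach))

end SpectralPropinquity

theorem mainTheorem2 (p : SpectralPropinquity.LeibnizParams)
    (T : ℕ → SpectralPropinquity.MetricSpectralTriple.{u} p)
    (T' : SpectralPropinquity.MetricSpectralTriple.{u} p)
    (hconv : Tendsto (fun n => SpectralPropinquity.spectralPropinquity (T n) T') atTop (𝓝 0)) :
    (∀ (μ : ℕ → ℝ) (τ : ∀ n, SpectralPropinquity.Tunnel (T n).mcc T'.mcc),
      (∀ n, SpectralPropinquity.spectralPropinquityStar (T n) T' < μ n) →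
      (∀ n, SpectralPropinquity.symMagnitude (τ n) (μ n) ≤ ENNReal.ofReal (μ n)) →
      Tendsto μ atTop (𝓝 0) →
      ∀ f : C₀(ℝ, ℂ),
        Tendsto
          (fun n => (τ n).separation
            (Sum.elim (fun t : SpectralPropinquity.symInterval (μ n) => (T n).adjU t)
              (fun _ : Unit => (T n).adjC0 f))
            (Sum.elim (fun t : SpectralPropinquity.symInterval (μ n) => T'.adjU t)
              (fun _ : Unit => T'.adjC0 f)))
          atTop (𝓝 0)) ∧
    ∀ f : C₀(ℝ, ℂ),
      Tendsto
        (fun n => SpectralPropinquity.operationalPropinquity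
          (fun _ : Unit => (T n).adjC0 f) (fun _ : Unit => T'.adjC0 f))
        atTop (𝓝 0) :=
  ⟨fun μ τ hlt hmag hμ f => SpectralPropinquity.tendsto_separation_calculus T T' μ τ
      -- As `Λ*` is nonnegative, `μ n > Λ*` forces `μ n > 0`, so the intervals of times `1 / (2 μ
      -- n)` exhaust `ℝ`.
      (fun n => (SpectralPropinquity.spectralPropinquityStar_nonneg _ _).trans_lt (hlt n))
      hmag hμ f.toBCF,
    fun f => SpectralPropinquity.tendsto_operationalPropinquity_calculus T T' hconv f.toBCF⟩
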